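/- Let $p$ be a prime, let $G\cong C_p\times C_p$ and let $N\leqslant G$ be a subgroup of order $p$. A $\mathbb{Z}_pG$-lattice is a $\mathbb{Z}_pG$-module that is free of finite rank over $\mathbb{Z}_p$; it is a permutation module if it has a $\mathbb{Z}_p$-basis that is set-wise preserved by the action of the group. For $H\leqslant G$ put $\widehat{H}=\sum_{h\in H}h$. Let $I$ be the set consisting of the symbol $0$ and the subgroups of $G$ of order $p$, and let $$e_0=\tfrac{1}{p^2}\widehat{G},\qquad e_H=\tfrac{1}{p^2}\bigl(p\widehat{H}-\widehat{G}\bigr)\quad(|H|=p)$$ be the primitive idempotents of $\mathbb{Q}_pG$; put $\Lambda_{(i)}=e_i\mathbb{Z}_pG$ for $i\in I$. A $\mathbb{Z}_pG$-lattice $U$ is reduced if it has neither non-zero free direct summands nor direct summands isomorphic to any $\Lambda_{(i)}$. The diagram of a reduced lattice $U$ is the tuple $V_*=(V;\,V_{(i)},\ i\in I)$ of $\mathbb{F}_p G$-modules defined, inside $\mathbb{Q}_p\otimes_{\mathbb{Z}_p}U\supseteq U$, by $$U_{(i)}=e_iU,\qquad U_*=\sum_{i\in I}U_{(i)},\qquad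 V=U_*/U,\qquad V_{(i)}=(U_{(i)}+U)/U .$$ Theorem. Let $U$ be a reduced $\mathbb{Z}_pG$-lattice with diagram $V_*$. Then the $\mathbb{Z}_p[G/N]$-module of $N$-invariants $U^N=\{u\in U : nu=u \text{ for all } n\in N\}$ is a permutation module if and only if ${V_{(N)}}^G\subseteq V_{(0)}$, where ${V_{(N)}}^G$ denotes the set of elements of $V_{(N)}$ fixed by $G$. -/

import Mathlib

open scoped TensorProduct

noncomputable section

namespace Butler

universe u v w

/-! ### Lattices, permutation modules, direct summands -/

/-- A representation `ρ` of `G` over `R` is a permutation module: it is free of finite rank over `R`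
and some `R`-basis of it is set-wise preserved by `G`. -/
def IsPermutationModule {R : Type u} {G : Type v} {V : Type w} [CommRing R] [Group G]
    [AddCommGroup V] [Module R V] (ρ : Representation R G V) : Prop :=
  ∃ (n : ℕ) (b : Module.Basis (Fin n) R V), ∀ (g : G) (i : Fin n), ∃ j : Fin n, ρ g (b i) = b j

/-- `ρ` has a direct summand isomorphic to `σ`. -/
def HasDirectSummand {R G V W : Type*} [CommRing R] [Group G]
    [AddCommGroup V] [Module R V] [AddCommGroup W] [Module R W]
    (ρ : Representation R G V) (σ : Representation R G W) : Prop :=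
  ∃ A B : Subrepresentation ρ, IsCompl A B ∧ Nonempty (A.toRepresentation.Equiv σ)

/-- Restriction of scalars of a representation along `ℤ_p → ℚ_p`. -/
def restrictToInt {p : ℕ} [Fact p.Prime] {G W : Type*} [Group G] [AddCommGroup W]
    [Module ℚ_[p] W] [Module ℤ_[p] W] [IsScalarTower ℤ_[p] ℚ_[p] W]
    (σ : Representation ℚ_[p] G W) : Representation ℤ_[p] G W where
  toFun g := (σ g).restrictScalars ℤ_[p]
  map_one' := by ext; simp
  map_mul' x y := by ext; simp

/-! ### The primitive idempotents of `ℚ_p G` and the algebras `Λ_(i)` -/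

/-- `G` is isomorphic to `C_p × C_p`. -/
def IsCpCp (p : ℕ) (G : Type*) [Group G] : Prop :=
  Nonempty (G ≃* Multiplicative (ZMod p) × Multiplicative (ZMod p))

/-- The indexing set `I` of the primitive idempotents of `ℚ_p G`:
the symbol `0`, and the subgroups of `G` of order `p`. -/
inductive Index (p : ℕ) (G : Type*) [Group G] where
  | zero : Index p G
  | sub (H : Subgroup G) (hH : Nat.card H = p) : Index p G

section Idempotents

variable (p : ℕ) [Fact p.Prime] {G : Type v} [CommGroup G] [Fintype G]

open Classical in
/-- The element `Ĥ = ∑_{h ∈ H} h` of `ℚ_p G`. -/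
def hat (H : Subgroup G) : MonoidAlgebra ℚ_[p] G :=
  ∑ g : G with g ∈ H, MonoidAlgebra.single g 1

/-- The idempotents `e_0 = Ĝ / p²` and `e_H = (p Ĥ - Ĝ) / p²` of `ℚ_p G`. -/
def idem : Index p G → MonoidAlgebra ℚ_[p] G
  | .zero => (1 / (p : ℚ_[p]) ^ 2) • hat p (⊤ : Subgroup G)
  | .sub H _ => (1 / (p : ℚ_[p]) ^ 2) • ((p : ℚ_[p]) • hat p H - hat p (⊤ : Subgroup G))

variable (G) in
/-- The inclusion `ℤ_p G → ℚ_p G`. -/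
def inclRat : MonoidAlgebra ℤ_[p] G →+* MonoidAlgebra ℚ_[p] G :=
  MonoidAlgebra.mapRingHom G (algebraMap ℤ_[p] ℚ_[p])

variable (G) in
/-- The reduction `ℤ_p G → 𝔽_p G`. -/
def redMod : MonoidAlgebra ℤ_[p] G →+* MonoidAlgebra (ZMod p) G :=
  MonoidAlgebra.mapRingHom G (PadicInt.toZMod (p := p))

/-- The map `a ↦ e_i a` from `ℤ_p G` to `ℚ_p G`. -/
def lambdaMap (i : Index p G) : MonoidAlgebra ℤ_[p] G →ₗ[ℤ_[p]] MonoidAlgebra ℚ_[p] G where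
  toFun a := idem p i * inclRat p G a
  map_add' a b := by rw [map_add, mul_add]
  map_smul' r a := by
    rw [Algebra.smul_def, map_mul, RingHom.id_apply, mul_left_comm]
    have h : inclRat p G (algebraMap ℤ_[p] (MonoidAlgebra ℤ_[p] G) r)
        = algebraMap ℤ_[p] (MonoidAlgebra ℚ_[p] G) r := by
      simp [inclRat]
    rw [h, ← Algebra.smul_def]

/-- `Λ_(i) = e_i ℤ_p G`, as a sub-`ℤ_p G`-module of `ℚ_p G`. -/
def lambdaSub (i : Index p G) :
    Subrepresentation (restrictToInt (Representation.leftRegular ℚ_[p] G)) where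
  toSubmodule := LinearMap.range (lambdaMap p i)
  apply_mem_toSubmodule := by
    rintro g _ ⟨a, rfl⟩
    refine ⟨MonoidAlgebra.single g 1 * a, ?_⟩
    have h : restrictToInt (p := p) (Representation.leftRegular ℚ_[p] G) g (lambdaMap p i a)
        = MonoidAlgebra.single g 1 * (idem p i * inclRat p G a) := by
      rw [← Representation.asAlgebraHom_ofMulAction_smul_eq_mul,
        Representation.asAlgebraHom_single, one_smul]
      rfl
    rw [h, mul_left_comm]
    simp [lambdaMap, inclRat]

/-- `Λ_(i)` as a `ℤ_p G`-lattice. -/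
abbrev lambdaRep (i : Index p G) :
    Representation ℤ_[p] G (lambdaSub p i).toSubmodule :=
  (lambdaSub p i).toRepresentation

end Idempotents

/-! ### Reduced lattices -/

section Lattice

variable {p : ℕ} [Fact p.Prime] {G : Type v} [CommGroup G] [Fintype G]
  {U : Type u} [AddCommGroup U] [Module ℤ_[p] U] (ρ : Representation ℤ_[p] G U)

/-- A lattice is reduced if it has neither non-zero free direct summands (equivalently, no direct
summand isomorphic to `ℤ_p G`), nor direct summands isomorphic to any `Λ_(i)`. -/
def IsReduced : Prop :=
  ¬ HasDirectSummand ρ (Representation.leftRegular ℤ_[p] G) ∧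
    ∀ i : Index p G, ¬ HasDirectSummand ρ (lambdaRep p i)

/-! ### The modules `U`, `U_(i)` and `U_*` inside `ℚ_p ⊗ U` -/

/-- The `ℚ_p G`-module `ℚ_p ⊗ U`. -/
def ratRep : Representation ℚ_[p] G (ℚ_[p] ⊗[ℤ_[p]] U) where
  toFun g := (ρ g).baseChange ℚ_[p]
  map_one' := by ext; simp
  map_mul' x y := by ext; simp

/-- `ℚ_p ⊗ U` as a `ℤ_p G`-module. -/
abbrev intRep : Representation ℤ_[p] G (ℚ_[p] ⊗[ℤ_[p]] U) := restrictToInt (ratRep ρ)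

/-- `U` regarded as the submodule `1 ⊗ U` of `ℚ_p ⊗ U`. -/
def latSub : Subrepresentation (intRep ρ) where
  toSubmodule := LinearMap.range (TensorProduct.mk ℤ_[p] ℚ_[p] U 1)
  apply_mem_toSubmodule := by
    rintro g _ ⟨u, rfl⟩
    exact ⟨ρ g u, by simp [restrictToInt, ratRep]⟩

/-- The submodule `U_(i) = e_i U` of `ℚ_p ⊗ U`. -/
def compSub (i : Index p G) : Subrepresentation (intRep ρ) where
  toSubmodule := (latSub ρ).toSubmodule.map
    (((ratRep ρ).asAlgebraHom (idem p i)).restrictScalars ℤ_[p])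
  apply_mem_toSubmodule := by
    rintro g _ ⟨w, hw, rfl⟩
    refine ⟨intRep ρ g w, (latSub ρ).apply_mem_toSubmodule g hw, ?_⟩
    have h := DFunLike.congr_fun (congrArg (ratRep ρ).asAlgebraHom
      (mul_comm (idem p i) (MonoidAlgebra.single g 1))) w
    simpa [restrictToInt] using h

/-- `U_* = ∑_i U_(i)`. -/
def starSub : Subrepresentation (intRep ρ) where
  toSubmodule := ⨆ i : Index p G, (compSub ρ i).toSubmodule
  apply_mem_toSubmodule := by
    intro g w hw
    have h : (⨆ i : Index p G, (compSub ρ i).toSubmodule) ≤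
        (⨆ i : Index p G, (compSub ρ i).toSubmodule).comap (intRep ρ g) :=
      iSup_le fun i x hx => Submodule.mem_iSup_of_mem i ((compSub ρ i).apply_mem_toSubmodule g hx)
    exact h hw

/-- The `ℤ_p`-module `V = U_* / U`. -/
abbrev QuotV : Type u :=
  (starSub ρ).toSubmodule ⧸ (latSub ρ).toSubmodule.submoduleOf (starSub ρ).toSubmodule

/-- The action of `G` on `V = U_* / U`. -/
def quotRep : Representation ℤ_[p] G (QuotV ρ) :=
  (starSub ρ).toRepresentation.quotient _ fun g x hx =>
    (latSub ρ).apply_mem_toSubmodule g (v := x.1) hx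

/-- The submodule `V_(i) = (U_(i) + U) / U` of `V = U_* / U`. -/
def quotSub (i : Index p G) : Subrepresentation (quotRep ρ) where
  toSubmodule := (((compSub ρ i).toSubmodule).submoduleOf (starSub ρ).toSubmodule).map
    (Submodule.mkQ _)
  apply_mem_toSubmodule := by
    rintro g _ ⟨x, hx, rfl⟩
    exact ⟨(starSub ρ).toRepresentation g x,
      (compSub ρ i).apply_mem_toSubmodule g (v := x.1) hx, rfl⟩

end Lattice

/-! ### Diagrams -/

/-- A diagram `V_* = (V; V_(i), i ∈ I)` for `G ≅ C_p × C_p`: a finitely generated `𝔽_p G`-module `V`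
with submodules `V_(i)` such that `∑_{i ≠ j} V_(i) = V` for every `j`, and such that the action of
`ℤ_p G` on `V_(i)` factors through `ℤ_p G → Λ_(i)`, `1 ↦ e_i`. -/
structure Diagram (p : ℕ) [Fact p.Prime] (G : Type v) [CommGroup G] [Fintype G] where
  V : Type u
  [addCommGroup : AddCommGroup V]
  [module : Module (ZMod p) V]
  [finite : Module.Finite (ZMod p) V]
  rep : Representation (ZMod p) G V
  sub : Index p G → Subrepresentation rep
  iSup_sub : ∀ j : Index p G, ⨆ i : Index p G, ⨆ _ : i ≠ j, (sub i).toSubmodule = ⊤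
  factors : ∀ (i : Index p G) (a : MonoidAlgebra ℤ_[p] G), lambdaMap p i a = 0 →
    ∀ x ∈ (sub i).toSubmodule, rep.asAlgebraHom (redMod p G a) x = 0

attribute [instance] Diagram.addCommGroup Diagram.module Diagram.finite

set_option linter.unusedSectionVars false

section Proofs

variable {p : ℕ} [hp : Fact p.Prime] {G : Type v} [CommGroup G] [Fintype G]
  {U : Type u} [AddCommGroup U] [Module ℤ_[p] U] (ρ : Representation ℤ_[p] G U)

theorem IsCpCp.pow_eq_one (hG : IsCpCp p G) (g : G) : g ^ p = 1 := by
  obtain ⟨e⟩ := hG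
  apply e.injective
  rw [map_pow, map_one]
  ext <;> apply Multiplicative.toAdd.injective <;> simp

theorem IsCpCp.card_eq (hG : IsCpCp p G) : Nat.card G = p ^ 2 := by
  obtain ⟨e⟩ := hG
  rw [Nat.card_congr e.toEquiv, Nat.card_prod]
  simp [sq]

/-- An element of `ℤ_p G` whose augmentation is a unit is a unit. -/
theorem isUnit_of_aug (hG : ∀ g : G, g ^ p = 1) (a : MonoidAlgebra ℤ_[p] G)
    (ha : IsUnit (∑ g : G, a.coeff g)) : IsUnit a := by
  by_contra hn
  obtain ⟨M, hM, haM⟩ := exists_max_ideal_of_mem_nonunits hn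
  have hc : (M.comap (algebraMap ℤ_[p] (MonoidAlgebra ℤ_[p] G))).IsMaximal :=
    Ideal.isMaximal_comap_of_isIntegral_of_isMaximal M
  have hm := IsLocalRing.eq_maximalIdeal hc
  have hpM : (p : MonoidAlgebra ℤ_[p] G) ∈ M := by
    have h : (p : ℤ_[p]) ∈ M.comap (algebraMap ℤ_[p] (MonoidAlgebra ℤ_[p] G)) := by
      rw [hm, IsLocalRing.mem_maximalIdeal]
      exact PadicInt.p_nonunit
    simpa using h
  have hp0 : (p : MonoidAlgebra ℤ_[p] G ⧸ M) = 0 := by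
    have := Ideal.Quotient.eq_zero_iff_mem.2 hpM
    simpa using this
  let _ := Ideal.Quotient.field M
  have : CharP (MonoidAlgebra ℤ_[p] G ⧸ M) p := by
    refine (CharP.charP_iff_prime_eq_zero hp.out).2 hp0
  have hg : ∀ g : G, Ideal.Quotient.mk M (MonoidAlgebra.single g 1) = 1 := by
    intro g
    have h1 : (Ideal.Quotient.mk M (MonoidAlgebra.single g 1) - 1) ^ p = 0 := by
      rw [sub_pow_char, ← map_pow, MonoidAlgebra.single_pow, hG]
      simp [← MonoidAlgebra.one_def]
    exact sub_eq_zero.1 (pow_eq_zero_iff hp.out.ne_zero |>.1 h1)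
  have hsum : a = ∑ g : G, algebraMap ℤ_[p] _ (a.coeff g) * MonoidAlgebra.single g 1 := by
    ext x
    simp [MonoidAlgebra.coeff_sum]
  have h2 : Ideal.Quotient.mk M a =
      Ideal.Quotient.mk M (algebraMap ℤ_[p] _ (∑ g : G, a.coeff g)) := by
    conv_lhs => rw [hsum]
    simp only [map_sum, map_mul, hg, mul_one]
  have h3 : algebraMap ℤ_[p] (MonoidAlgebra ℤ_[p] G) (∑ g : G, a.coeff g) ∈ M := by
    rw [← Ideal.Quotient.eq_zero_iff_mem, ← h2]
    exact Ideal.Quotient.eq_zero_iff_mem.2 haM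
  exact hM.ne_top (Ideal.eq_top_of_isUnit_mem _ h3 (ha.map _))

/-- A lattice with an element whose norm is not divisible by `p` has a free summand. -/
theorem norm_mem_of_no_free [Module.Free ℤ_[p] U] [Module.Finite ℤ_[p] U]
    (hG : ∀ g : G, g ^ p = 1)
    (h : ¬ HasDirectSummand ρ (Representation.leftRegular ℤ_[p] G)) (u : U) :
    ∃ w : U, ρ.norm u = (p : ℤ_[p]) • w := by
  by_contra hu
  apply h
  let b := Module.Free.chooseBasis ℤ_[p] U
  have hi : ∃ i, IsUnit (b.repr (ρ.norm u) i) := by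
    by_contra hcon
    push Not at hcon
    have h1 : ∀ i, ∃ c, b.repr (ρ.norm u) i = (p : ℤ_[p]) * c := by
      intro i
      have h2 := (IsLocalRing.mem_maximalIdeal _).2 (hcon i)
      rw [PadicInt.maximalIdeal_eq_span_p, Ideal.mem_span_singleton] at h2
      exact h2
    choose c hc using h1
    apply hu
    refine ⟨∑ i, c i • b i, ?_⟩
    rw [Finset.smul_sum]
    conv_lhs => rw [← b.sum_repr (ρ.norm u)]
    exact Finset.sum_congr rfl fun i _ => by rw [hc, mul_smul]
  obtain ⟨i, hi⟩ := hi
  -- the equivariant map to the group ring defined by a coordinate function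
  let Φ : U →ₗ[ℤ_[p]] MonoidAlgebra ℤ_[p] G :=
    ∑ g : G, (MonoidAlgebra.lsingle g) ∘ₗ (b.coord i) ∘ₗ (ρ g⁻¹)
  have hΦc : ∀ x g, (Φ x).coeff g = b.coord i (ρ g⁻¹ x) := by
    intro x g
    classical
    simp [Φ, MonoidAlgebra.coeff_sum, Finsupp.finsetSum_apply, Finsupp.single_apply]
  have hΦ : ∀ g x, Φ (ρ g x) = MonoidAlgebra.single g 1 * Φ x := by
    intro g x
    ext y
    rw [hΦc, MonoidAlgebra.coeff_single_mul_apply, hΦc]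
    simp [← Module.End.mul_apply, ← map_mul]
  have hu' : IsUnit (Φ u) := by
    apply isUnit_of_aug hG
    have : ∑ g : G, (Φ u).coeff g = b.repr (ρ.norm u) i := by
      simp only [hΦc, Representation.norm, LinearMap.sum_apply, map_sum, Finsupp.finsetSum_apply]
      exact Fintype.sum_equiv (Equiv.inv G) _ _ fun g => by simp
    rw [this]; exact hi
  obtain ⟨a, ha⟩ := hu'
  let s : MonoidAlgebra ℤ_[p] G →ₗ[ℤ_[p]] U := (LinearMap.applyₗ u) ∘ₗ ρ.asAlgebraHom.toLinearMap
  have hs : ∀ x, s x = ρ.asAlgebraHom x u := fun x => rfl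
  have hsg : ∀ g x, s (MonoidAlgebra.single g 1 * x) = ρ g (s x) := by
    intro g x; simp [hs]
  have hΦs : ∀ x, Φ (s x) = x * Φ u := by
    intro x
    rw [hs]
    induction x using MonoidAlgebra.induction_linear with
    | zero => simp
    | add x y hx hy => simp only [map_add, LinearMap.add_apply, hx, hy, add_mul]
    | single g r =>
      rw [Representation.asAlgebraHom_single, LinearMap.smul_apply, map_smul, hΦ, ← smul_mul_assoc,
        MonoidAlgebra.smul_single, smul_eq_mul, mul_one]
  have hinj : Function.Injective s := by
    intro x y hxy
    have := congrArg Φ hxy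
    rw [hΦs, hΦs, ← ha] at this
    exact (Units.mul_left_inj a).1 this
  refine ⟨⟨LinearMap.range s, ?_⟩, ⟨LinearMap.ker Φ, ?_⟩, ?_, ⟨?_⟩⟩
  · rintro g _ ⟨x, rfl⟩
    exact ⟨_, hsg g x⟩
  · intro g x hx
    rw [LinearMap.mem_ker] at hx ⊢
    rw [hΦ, hx, mul_zero]
  · constructor
    · rw [disjoint_iff]
      apply Subrepresentation.toSubmodule_injective
      rw [Subrepresentation.toSubmodule_inf]
      change LinearMap.range s ⊓ LinearMap.ker Φ = ⊥
      rw [eq_bot_iff]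
      rintro _ ⟨⟨x, rfl⟩, hx⟩
      have hx' : Φ (s x) = 0 := hx
      rw [hΦs, ← ha, Units.mul_left_eq_zero] at hx'
      simp [hx']
    · rw [codisjoint_iff]
      apply Subrepresentation.toSubmodule_injective
      rw [Subrepresentation.toSubmodule_sup]
      change LinearMap.range s ⊔ LinearMap.ker Φ = ⊤
      rw [eq_top_iff]
      intro x _
      rw [Submodule.mem_sup]
      refine ⟨s (Φ x * ↑a⁻¹), ⟨_, rfl⟩, x - s (Φ x * ↑a⁻¹), ?_, by abel⟩
      rw [LinearMap.mem_ker, map_sub, hΦs, ← ha, mul_assoc, Units.inv_mul, mul_one, sub_self]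
  · refine Representation.Equiv.symm (Representation.Equiv.mk (LinearEquiv.ofInjective s hinj) ?_)
    intro g
    ext x : 2
    apply Subtype.ext
    change s (Representation.leftRegular ℤ_[p] G g _) = ρ g (s _)
    rw [← hsg, ← Representation.asAlgebraHom_ofMulAction_smul_eq_mul,
        Representation.asAlgebraHom_single, one_smul]


theorem asAlgebraHom_hat_top (u : U) :
    (ratRep ρ).asAlgebraHom (hat p ⊤) (1 ⊗ₜ u) = (1 : ℚ_[p]) ⊗ₜ[ℤ_[p]] ρ.norm u := by
  simp [hat, ratRep, Representation.norm, LinearMap.sum_apply, TensorProduct.tmul_sum]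

theorem asAlgebraHom_hat_mem (H : Subgroup G) (u : U) :
    (ratRep ρ).asAlgebraHom (hat p H) (1 ⊗ₜ u) ∈ (latSub ρ).toSubmodule := by
  classical
  simp only [hat, map_sum, LinearMap.sum_apply]
  refine Submodule.sum_mem _ fun g _ => ?_
  exact ⟨ρ g u, by simp [ratRep]⟩

/-- `p U_(i) ⊆ U` for a lattice `U` without free summands. -/
theorem smul_idem_mem [Module.Free ℤ_[p] U] [Module.Finite ℤ_[p] U] (hG : ∀ g : G, g ^ p = 1)
    (h : ¬ HasDirectSummand ρ (Representation.leftRegular ℤ_[p] G)) (i : Index p G) (u : U) :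
    (p : ℤ_[p]) • (ratRep ρ).asAlgebraHom (idem p i) (1 ⊗ₜ u) ∈ (latSub ρ).toSubmodule := by
  have hp0 : (p : ℚ_[p]) ≠ 0 := by exact_mod_cast hp.out.ne_zero
  obtain ⟨w, hw⟩ := norm_mem_of_no_free ρ hG h u
  have hcast : ∀ x : ℚ_[p] ⊗[ℤ_[p]] U, (p : ℤ_[p]) • x = (p : ℚ_[p]) • x := by
    intro x
    rw [← algebraMap_smul ℚ_[p] (p : ℤ_[p]) x]
    simp
  have htop : (ratRep ρ).asAlgebraHom (hat p ⊤) (1 ⊗ₜ u) = (p : ℚ_[p]) • (1 : ℚ_[p]) ⊗ₜ[ℤ_[p]] w := by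
    rw [asAlgebraHom_hat_top, hw, TensorProduct.tmul_smul, hcast]
  have hwm : (1 : ℚ_[p]) ⊗ₜ[ℤ_[p]] w ∈ (latSub ρ).toSubmodule := ⟨w, rfl⟩
  rw [hcast]
  cases i with
  | zero =>
    rw [idem, map_smul, LinearMap.smul_apply, htop, smul_smul, smul_smul]
    have : (p : ℚ_[p]) * (1 / (p : ℚ_[p]) ^ 2) * p = 1 := by field_simp
    rw [this, one_smul]
    exact hwm
  | sub H hH =>
    rw [idem, map_smul, LinearMap.smul_apply, map_sub, map_smul, LinearMap.sub_apply,
      LinearMap.smul_apply, htop, ← smul_sub, smul_smul, smul_smul]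
    have : (p : ℚ_[p]) * (1 / (p : ℚ_[p]) ^ 2) * p = 1 := by field_simp
    rw [this, one_smul]
    exact Submodule.sub_mem _ (asAlgebraHom_hat_mem ρ H u) hwm

theorem smul_star_mem [Module.Free ℤ_[p] U] [Module.Finite ℤ_[p] U] (hG : ∀ g : G, g ^ p = 1)
    (h : ¬ HasDirectSummand ρ (Representation.leftRegular ℤ_[p] G)) (x : ℚ_[p] ⊗[ℤ_[p]] U)
    (hx : x ∈ (starSub ρ).toSubmodule) : (p : ℤ_[p]) • x ∈ (latSub ρ).toSubmodule := by
  have hle : (starSub ρ).toSubmodule ≤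
      (latSub ρ).toSubmodule.comap (LinearMap.lsmul ℤ_[p] _ (p : ℤ_[p])) := by
    refine iSup_le fun i => ?_
    rintro _ ⟨_, ⟨u, rfl⟩, rfl⟩
    exact smul_idem_mem ρ hG h i u
  exact hle hx

/-- `p` annihilates `V = U_* / U` for a reduced lattice `U`. -/
theorem nsmul_quotV [Module.Free ℤ_[p] U] [Module.Finite ℤ_[p] U] (hG : IsCpCp p G)
    (h : IsReduced ρ) (x : QuotV ρ) : p • x = 0 := by
  obtain ⟨y, rfl⟩ := Submodule.mkQ_surjective _ x
  rw [← map_nsmul, Submodule.mkQ_apply, Submodule.Quotient.mk_eq_zero, Submodule.submoduleOf,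
    Submodule.mem_comap]
  have := smul_star_mem ρ hG.pow_eq_one h.1 y.1 y.2
  rw [Nat.cast_smul_eq_nsmul] at this
  exact this

/-- `Option` description of the index set. -/
def indexEquiv : Index p G ≃ Option {H : Subgroup G // Nat.card H = p} where
  toFun
    | .zero => none
    | .sub H hH => some ⟨H, hH⟩
  invFun
    | none => .zero
    | some H => .sub H.1 H.2
  left_inv := by rintro (_ | _) <;> rfl
  right_inv := by rintro (_ | _) <;> rfl

instance : Finite (Index p G) := Finite.of_equiv _ indexEquiv.symm

theorem unique_subgroup (hG : ∀ g : G, g ^ p = 1) (g : G) (hg : g ≠ 1) (H : Subgroup G) :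
    (Nat.card H = p ∧ g ∈ H) ↔ H = Subgroup.zpowers g := by
  have ho : Nat.card (Subgroup.zpowers g) = p := by
    rw [Nat.card_zpowers]
    exact orderOf_eq_prime (hG g) hg
  constructor
  · rintro ⟨hH, hgH⟩
    have : Finite H := Nat.finite_of_card_ne_zero (by rw [hH]; exact hp.out.ne_zero)
    exact (Subgroup.eq_of_le_of_card_ge (by simpa using hgH) (by rw [hH, ho])).symm
  · rintro rfl
    exact ⟨ho, Subgroup.mem_zpowers g⟩

theorem coeff_hat (H : Subgroup G) (g : G) [Decidable (g ∈ H)] :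
    (hat p H).coeff g = if g ∈ H then 1 else 0 := by
  classical
  simp [hat, MonoidAlgebra.coeff_sum, Finsupp.single_apply]

open Classical in
theorem sum_idem (hG : IsCpCp p G) [Fintype (Index p G)] :
    ∑ i : Index p G, idem p i = (1 : MonoidAlgebra ℚ_[p] G) := by
  have hp0 : (p : ℚ_[p]) ≠ 0 := by exact_mod_cast hp.out.ne_zero
  have hp1 : (p : ℚ_[p]) - 1 ≠ 0 := by
    rw [sub_ne_zero]; exact_mod_cast hp.out.one_lt.ne'
  let S := {H : Subgroup G // Nat.card H = p}
  -- the number of subgroups containing a given element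
  have h1 : ∀ g : G, g ≠ 1 → ∑ H : S, (if g ∈ H.1 then (1 : ℚ_[p]) else 0) = 1 := by
    intro g hg
    have hz := (unique_subgroup hG.pow_eq_one g hg (Subgroup.zpowers g)).2 rfl
    rw [Finset.sum_eq_single ⟨Subgroup.zpowers g, hz.1⟩]
    · simp
    · intro H _ hH
      rw [if_neg]
      intro hgH
      exact hH (Subtype.ext ((unique_subgroup hG.pow_eq_one g hg H.1).1 ⟨H.2, hgH⟩))
    · simp
  have h2 : ∑ H : S, (if (1 : G) ∈ H.1 then (1 : ℚ_[p]) else 0) = Fintype.card S := by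
    simp [one_mem]
  have h3 : ∀ H : S, ∑ g : G, (if g ∈ H.1 then (1 : ℚ_[p]) else 0) = p := by
    intro H
    rw [Finset.sum_boole]
    have : (Finset.univ.filter fun g : G => g ∈ H.1).card = p := by
      rw [← Fintype.card_subtype, ← Nat.card_eq_fintype_card]
      exact H.2
    rw [this]
  have hcardG : (Fintype.card G : ℚ_[p]) = (p : ℚ_[p]) ^ 2 := by
    rw [← Nat.card_eq_fintype_card, hG.card_eq]; push_cast; rfl
  have h4 : (Fintype.card S : ℚ_[p]) = p + 1 := by
    have e1 : ∑ H : S, ∑ g : G, (if g ∈ H.1 then (1 : ℚ_[p]) else 0) = Fintype.card S * p := by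
      simp [h3]
    rw [Finset.sum_comm, ← Finset.add_sum_erase _ _ (Finset.mem_univ (1 : G)), h2,
      Finset.sum_congr rfl fun g hg => h1 g (Finset.ne_of_mem_erase hg)] at e1
    rw [Finset.sum_const, Finset.card_erase_of_mem (Finset.mem_univ _), Finset.card_univ,
      nsmul_one, Nat.cast_sub Fintype.card_pos, hcardG] at e1
    have e2 : ((p : ℚ_[p]) - 1) * Fintype.card S = (p - 1) * (p + 1) := by
      push_cast at e1
      linear_combination -e1
    exact mul_left_cancel₀ hp1 e2
  have hsum : ∑ i : Index p G, idem p i = idem p (.zero : Index p G) +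
      ∑ H : S, idem p (.sub H.1 H.2) := by
    rw [← Equiv.sum_comp indexEquiv.symm, Fintype.sum_option]
    rfl
  rw [hsum]
  ext g
  simp only [MonoidAlgebra.coeff_add, MonoidAlgebra.coeff_sum, Finsupp.add_apply,
    Finsupp.finsetSum_apply, idem, MonoidAlgebra.coeff_smul, MonoidAlgebra.coeff_sub,
    Finsupp.smul_apply, Finsupp.sub_apply, smul_eq_mul, coeff_hat, Subgroup.mem_top, if_true]
  rw [← Finset.mul_sum, Finset.sum_sub_distrib, ← Finset.mul_sum, Finset.sum_const,
    Finset.card_univ, nsmul_one, h4, MonoidAlgebra.one_def, MonoidAlgebra.coeff_single,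
    Finsupp.single_apply]
  by_cases hg : g = 1
  · subst hg
    rw [h2, h4]
    simp
    field_simp
    ring
  · rw [h1 g hg, if_neg (Ne.symm hg)]
    ring

/-- `∑_{i ≠ j} V_(i) = V` for each `j`. -/
theorem iSup_quotSub (hG : IsCpCp p G) (j : Index p G) :
    ⨆ i : Index p G, ⨆ _ : i ≠ j, (quotSub ρ i).toSubmodule = ⊤ := by
  classical
  let _ := Fintype.ofFinite (Index p G)
  let π := ((latSub ρ).toSubmodule.submoduleOf (starSub ρ).toSubmodule).mkQ
  have hmem : ∀ (i : Index p G) (u : U),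
      (ratRep ρ).asAlgebraHom (idem p i) (1 ⊗ₜ u) ∈ (starSub ρ).toSubmodule := fun i u =>
    Submodule.mem_iSup_of_mem i ⟨_, ⟨u, rfl⟩, rfl⟩
  have hV : ∀ (i : Index p G) (u : U),
      π ⟨_, hmem i u⟩ ∈ (quotSub ρ i).toSubmodule := fun i u =>
    ⟨⟨_, hmem i u⟩, ⟨_, ⟨u, rfl⟩, rfl⟩, rfl⟩
  have hne : ∀ (i : Index p G) (u : U), i ≠ j →
      π ⟨_, hmem i u⟩ ∈ ⨆ i : Index p G, ⨆ _ : i ≠ j, (quotSub ρ i).toSubmodule :=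
    fun i u hij => Submodule.mem_iSup_of_mem i (Submodule.mem_iSup_of_mem hij (hV i u))
  have hall : ∀ (i : Index p G) (u : U),
      π ⟨_, hmem i u⟩ ∈ ⨆ i : Index p G, ⨆ _ : i ≠ j, (quotSub ρ i).toSubmodule := by
    intro i u
    by_cases hij : i = j
    · subst hij
      have hs : ∑ k, π ⟨_, hmem k u⟩ = 0 := by
        rw [← map_sum, Submodule.mkQ_apply, Submodule.Quotient.mk_eq_zero,
          Submodule.submoduleOf,
    Submodule.mem_comap]
        refine ⟨u, ?_⟩
        rw [map_sum]
        change (1 : ℚ_[p]) ⊗ₜ[ℤ_[p]] u = ∑ k, (ratRep ρ).asAlgebraHom (idem p k) (1 ⊗ₜ u)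
        rw [← LinearMap.sum_apply, ← map_sum, sum_idem hG, map_one, Module.End.one_apply]
      rw [← Finset.add_sum_erase _ _ (Finset.mem_univ i)] at hs
      rw [eq_neg_of_add_eq_zero_left hs]
      exact Submodule.neg_mem _ (Submodule.sum_mem _ fun k hk =>
        hne k u (Finset.ne_of_mem_erase hk))
    · exact hne i u hij
  rw [eq_top_iff]
  rintro x -
  obtain ⟨⟨y, hy⟩, rfl⟩ := Submodule.mkQ_surjective _ x
  refine Submodule.iSup_induction' (fun i => (compSub ρ i).toSubmodule)
    (motive := fun y hy => π ⟨y, hy⟩ ∈ ⨆ i : Index p G, ⨆ _ : i ≠ j, (quotSub ρ i).toSubmodule)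
    ?_ ?_ ?_ hy
  · rintro i _ ⟨_, ⟨u, rfl⟩, rfl⟩
    exact hall i u
  · exact Submodule.zero_mem _
  · intro y z hy hz h1 h2
    exact Submodule.add_mem _ h1 h2

theorem intRep_asAlgebraHom (a : MonoidAlgebra ℤ_[p] G) (w : ℚ_[p] ⊗[ℤ_[p]] U) :
    (intRep ρ).asAlgebraHom a w = (ratRep ρ).asAlgebraHom (inclRat p G a) w := by
  induction a using MonoidAlgebra.induction_linear with
  | zero => simp
  | add x y hx hy => simp only [map_add, LinearMap.add_apply, hx, hy]
  | single g r =>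
    simp only [inclRat, MonoidAlgebra.mapRingHom_single, Representation.asAlgebraHom_single,
      LinearMap.smul_apply, algebraMap_smul]
    rfl

/-- The action of `ℤ_p G` on `V_(i)` factors through `ℤ_p G → Λ_(i)`. -/
theorem quotRep_factors (i : Index p G) (a : MonoidAlgebra ℤ_[p] G) (ha : lambdaMap p i a = 0)
    (x : QuotV ρ) (hx : x ∈ (quotSub ρ i).toSubmodule) : (quotRep ρ).asAlgebraHom a x = 0 := by
  obtain ⟨⟨y, hy⟩, hyi, rfl⟩ := hx
  have key : ∀ b : MonoidAlgebra ℤ_[p] G, ∀ y : (starSub ρ).toSubmodule,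
      ∃ h : (intRep ρ).asAlgebraHom b y.1 ∈ (starSub ρ).toSubmodule,
      (quotRep ρ).asAlgebraHom b (Submodule.mkQ _ y) =
        Submodule.mkQ _ ⟨(intRep ρ).asAlgebraHom b y.1, h⟩ := by
    intro b y
    induction b using MonoidAlgebra.induction_linear with
    | zero =>
      refine ⟨by simp, ?_⟩
      simp only [map_zero, LinearMap.zero_apply]
      exact (map_zero _).symm
    | add x z hx hz =>
      obtain ⟨h1, e1⟩ := hx
      obtain ⟨h2, e2⟩ := hz
      refine ⟨by simpa using Submodule.add_mem _ h1 h2, ?_⟩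
      rw [map_add, LinearMap.add_apply, e1, e2, ← map_add]
      simp
    | single g r =>
      refine ⟨?_, ?_⟩
      · rw [Representation.asAlgebraHom_single]
        exact Submodule.smul_mem _ _ ((starSub ρ).apply_mem_toSubmodule g y.2)
      · simp only [Representation.asAlgebraHom_single]
        rfl
  obtain ⟨h, e⟩ := key a ⟨y, hy⟩
  rw [e]
  obtain ⟨w, -, rfl⟩ := hyi
  have h0 : (intRep ρ).asAlgebraHom a ((ratRep ρ).asAlgebraHom (idem p i) w) = 0 := by
    rw [intRep_asAlgebraHom, ← Module.End.mul_apply, ← map_mul, mul_comm]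
    have ha' : idem p i * inclRat p G a = 0 := ha
    rw [ha', map_zero, LinearMap.zero_apply]
  have : (⟨_, h⟩ : (starSub ρ).toSubmodule) = 0 := Subtype.ext h0
  rw [this, map_zero]

theorem finite_quotV [Module.Finite ℤ_[p] U] : Module.Finite ℤ_[p] (QuotV ρ) := by
  have h1 : ∀ i, (compSub ρ i).toSubmodule.FG := fun i =>
    Submodule.FG.map _ (Module.Finite.iff_fg.1
      (Module.Finite.range (TensorProduct.mk ℤ_[p] ℚ_[p] U 1)))
  have h2 : (starSub ρ).toSubmodule.FG := Submodule.fg_iSup _ h1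
  have : Module.Finite ℤ_[p] (starSub ρ).toSubmodule := Module.Finite.iff_fg.2 h2
  infer_instance

end Proofs
section DiagramOf

variable {p : ℕ} [Fact p.Prime] {G : Type v} [CommGroup G] [Fintype G]
  {U : Type u} [AddCommGroup U] [Module ℤ_[p] U]

/-- On a `ℤ_p`-module annihilated by `p`, the scalar action of `ℤ_p` is that of `𝔽_p`. -/
theorem toZMod_smul {M : Type*} [AddCommGroup M] [Module ℤ_[p] M] [Module (ZMod p) M]
    (r : ℤ_[p]) (x : M) : PadicInt.toZMod r • x = r • x := by
  have hx : ∀ y : M, (p : ℤ_[p]) • y = 0 := by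
    intro y
    rw [Nat.cast_smul_eq_nsmul, ← Nat.cast_smul_eq_nsmul (ZMod p), CharP.cast_eq_zero, zero_smul]
  have h := PadicInt.toZMod_spec r
  rw [PadicInt.maximalIdeal_eq_span_p, Ideal.mem_span_singleton] at h
  obtain ⟨c, hc⟩ := h
  have e : r = (PadicInt.toZMod r).val + p * c := by
    rw [← hc, ZMod.cast_eq_val]; ring
  conv_rhs => rw [e, add_smul, mul_smul, hx, add_zero, Nat.cast_smul_eq_nsmul]
  rw [← Nat.cast_smul_eq_nsmul (ZMod p), ZMod.natCast_zmod_val]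

section Reduce

variable {M : Type*} [AddCommGroup M] [Module ℤ_[p] M] [Module (ZMod p) M]

/-- A `ℤ_p G`-module annihilated by `p`, as an `𝔽_p G`-module. -/
def reduceRep (τ : Representation ℤ_[p] G M) : Representation (ZMod p) G M where
  toFun g := (τ g).toAddMonoidHom.toZModLinearMap p
  map_one' := by ext x; simp
  map_mul' g h := by ext x; simp

/-- A `ℤ_p G`-submodule of a module annihilated by `p`, as an `𝔽_p G`-submodule. -/
def reduceSub {τ : Representation ℤ_[p] G M} (S : Subrepresentation τ) :
    Subrepresentation (reduceRep τ) where
  toSubmodule := AddSubgroup.toZModSubmodule p S.toSubmodule.toAddSubgroup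
  apply_mem_toSubmodule g _ hx := S.apply_mem_toSubmodule g hx

theorem finite_reduce (h : Module.Finite ℤ_[p] M) : Module.Finite (ZMod p) M := by
  obtain ⟨S, hS⟩ := h.fg_top
  refine ⟨⟨S, ?_⟩⟩
  rw [eq_top_iff]
  rintro x -
  have hx : x ∈ Submodule.span ℤ_[p] (S : Set M) := hS ▸ Submodule.mem_top
  induction hx using Submodule.span_induction with
  | mem x hx => exact Submodule.subset_span hx
  | zero => exact Submodule.zero_mem _
  | add x y _ _ hx hy => exact Submodule.add_mem _ hx hy
  | smul r x _ hx =>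
    rw [← toZMod_smul]
    exact Submodule.smul_mem _ _ hx

theorem iSup_reduce {τ : Representation ℤ_[p] G M} (S : Index p G → Subrepresentation τ)
    (j : Index p G) (h : ⨆ i : Index p G, ⨆ _ : i ≠ j, (S i).toSubmodule = ⊤) :
    ⨆ i : Index p G, ⨆ _ : i ≠ j, (reduceSub (S i)).toSubmodule = ⊤ := by
  rw [eq_top_iff]
  rintro x -
  have hx : x ∈ ⨆ i : Index p G, ⨆ _ : i ≠ j, (S i).toSubmodule := h ▸ Submodule.mem_top
  refine Submodule.iSup_induction _
    (motive := fun x => x ∈ ⨆ i : Index p G, ⨆ _ : i ≠ j, (reduceSub (S i)).toSubmodule)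
    hx ?_ (Submodule.zero_mem _) fun _ _ h1 h2 => Submodule.add_mem _ h1 h2
  intro i y hy
  by_cases hij : i = j
  · simp only [hij, ne_eq, not_true_eq_false, iSup_false, Submodule.mem_bot] at hy
    rw [hy]
    exact Submodule.zero_mem _
  · simp only [ne_eq, hij, not_false_eq_true, iSup_pos] at hy
    exact Submodule.mem_iSup_of_mem i (Submodule.mem_iSup_of_mem hij hy)

theorem reduceRep_asAlgebraHom (τ : Representation ℤ_[p] G M) (a : MonoidAlgebra ℤ_[p] G) (x : M) :
    (reduceRep τ).asAlgebraHom (redMod p G a) x = τ.asAlgebraHom a x := by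
  induction a using MonoidAlgebra.induction_linear with
  | zero => simp
  | add a b ha hb => simp only [map_add, LinearMap.add_apply, ha, hb]
  | single g r =>
    simp only [redMod, MonoidAlgebra.mapRingHom_single, Representation.asAlgebraHom_single,
      LinearMap.smul_apply]
    exact toZMod_smul r _

end Reduce

/-- The diagram `(U_* / U; (U_(i) + U) / U, i ∈ I)` of a reduced lattice `U`. -/
def diagram [Module.Free ℤ_[p] U] [Module.Finite ℤ_[p] U] (hG : IsCpCp p G)
    (ρ : Representation ℤ_[p] G U) (hρ : IsReduced ρ) : Diagram.{u, v} p G :=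
  letI : Module (ZMod p) (QuotV ρ) := AddCommGroup.zmodModule (nsmul_quotV ρ hG hρ)
  { V := QuotV ρ
    finite := finite_reduce (finite_quotV ρ)
    rep := reduceRep (quotRep ρ)
    sub := fun i => reduceSub (quotSub ρ i)
    iSup_sub := fun j => iSup_reduce _ j (iSup_quotSub ρ hG j)
    factors := fun i a ha x hx =>
      (reduceRep_asAlgebraHom _ a x).trans (quotRep_factors ρ i a ha x hx) }

end DiagramOf

end Butler

end

noncomputable section

namespace Butler

set_option linter.unusedSectionVars false

/-! ### Lattices for a group of prime order -/

section PrimeOrder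

/-! Let `c` generate `G` modulo `N`, and let `C = G/N`, a group of order `p`. Both sides of the
equivalence express the vanishing of one cohomology group: every `u ∈ U^N` of norm zero has the form
`c m - m` with `m ∈ U^N`.

On the module side, a permutation lattice has this property, because the norm is multiplication by
`|C|` after passing to coinvariants, which are free (`IsPermutationModule.mem_coinvariants_ker`).
Conversely (`isPermutationModule_of_norm`), free summands can be split off by induction on the rank.
Once none is left every norm is divisible by `p`, so each `y` differs from a fixed vector by an
element of norm zero. Hence `(c - 1)M = (c - 1)²M`. As `c - 1` is nilpotent modulo `p`, this forces
`(c - 1)M = 0`, and the action is trivial.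

On the diagram side, the elements of `U^N` of norm zero are those `u ∈ U` with `e_N u = u`. If
`Λ_(N)` is not a summand, each of them is `(c - 1)x` with `x ∈ U_(N)` (`exists_compSub_sub_eq`):
otherwise `Λ_(N) → U`, `y ↦ y u`, would split. The class of `x` in `V` is fixed by `G`, since `(c -
1)x ∈ U`. If it lies in `V_(0)`, subtract from `x` an element of `U_(0)`: this gives `m ∈ U^N` with
the same image under `c - 1`. In the other direction, a fixed class `v` in `V_(N)` yields `(c - 1)v
= (c - 1)m` with `m ∈ U^N`. Then `v - m` is fixed by `G`, which gives `v = e_N m`, congruent to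
`-e_0 m` modulo `U`. -/

theorem IsPermutationModule.of_basis {R G V ι : Type*} [CommRing R] [Group G]
    [AddCommGroup V] [Module R V] [Finite ι] {ρ : Representation R G V} (b : Module.Basis ι R V)
    (h : ∀ g i, ∃ j, ρ g (b i) = b j) : IsPermutationModule ρ := by
  obtain ⟨n, ⟨e⟩⟩ := Finite.exists_equiv_fin ι
  refine ⟨n, b.reindex e, fun g i => ?_⟩
  obtain ⟨j, hj⟩ := h g (e.symm i)
  exact ⟨e j, by simp [hj]⟩

theorem IsPermutationModule.of_isCompl {R G V : Type*} [CommRing R] [Group G]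
    [AddCommGroup V] [Module R V] {ρ : Representation R G V} {A B : Subrepresentation ρ}
    (h : IsCompl A.toSubmodule B.toSubmodule) (hA : IsPermutationModule A.toRepresentation)
    (hB : IsPermutationModule B.toRepresentation) : IsPermutationModule ρ := by
  obtain ⟨n, a, ha⟩ := hA
  obtain ⟨m, b, hb⟩ := hB
  refine .of_basis ((a.prod b).map (Submodule.prodEquivOfIsCompl _ _ h)) fun g i => ?_
  rcases i with i | i
  · obtain ⟨j, hj⟩ := ha g i
    have h2 : ρ g (a i) = a j := congrArg Subtype.val hj
    exact ⟨.inl j, by simp [h2]⟩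
  · obtain ⟨j, hj⟩ := hb g i
    have h2 : ρ g (b i) = b j := congrArg Subtype.val hj
    exact ⟨.inr j, by simp [h2]⟩

theorem IsPermutationModule.leftRegular {R G : Type*} [CommRing R] [Group G] [Finite G] :
    IsPermutationModule (Representation.leftRegular R G) := by
  refine .of_basis (⟨MonoidAlgebra.coeffLinearEquiv R⟩ : Module.Basis G R (MonoidAlgebra R G))
    fun g i => ⟨g * i, ?_⟩
  change Representation.leftRegular R G g (MonoidAlgebra.single i 1) =
    MonoidAlgebra.single (g * i) 1
  simp

theorem IsPermutationModule.of_equiv {R G V W : Type*} [CommRing R] [Group G]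
    [AddCommGroup V] [Module R V] [AddCommGroup W] [Module R W] {ρ : Representation R G V}
    {σ : Representation R G W} (e : ρ.Equiv σ) (h : IsPermutationModule σ) :
    IsPermutationModule ρ := by
  obtain ⟨n, b, hb⟩ := h
  refine ⟨n, b.map e.toLinearEquiv.symm, fun g i => ?_⟩
  obtain ⟨j, hj⟩ := hb g i
  refine ⟨j, e.toLinearEquiv.injective ?_⟩
  have := Representation.IntertwiningMap.isIntertwining ρ σ e.toIntertwiningMap g
    (e.toLinearEquiv.symm (b i))
  have h2 : e (e.toLinearEquiv.symm (b i)) = b i := e.toLinearEquiv.apply_symm_apply (b i)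
  have h3 : e (e.toLinearEquiv.symm (b j)) = b j := e.toLinearEquiv.apply_symm_apply (b j)
  change e (ρ g (e.toLinearEquiv.symm (b i))) = e (e.toLinearEquiv.symm (b j))
  rw [h3, ← hj]
  exact this.trans (congrArg (σ g) h2)

/-- In a permutation module over a domain of characteristic zero, an element of norm
zero is a sum of elements `g x - x`. -/
theorem IsPermutationModule.mem_coinvariants_ker {R G V : Type*} [CommRing R] [IsDomain R]
    [CharZero R] [Group G] [Fintype G] [AddCommGroup V] [Module R V] {ρ : Representation R G V}
    (h : IsPermutationModule ρ) {v : V} (hv : ρ.norm v = 0) :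
    v ∈ Representation.Coinvariants.ker ρ := by
  obtain ⟨n, b, hb⟩ := h
  -- The orbits on the basis. Below, `S` sends a vector to its coefficient sum over each orbit, and
  -- `T` sends an orbit to a chosen representative, so `T ∘ S` is the identity modulo coinvariants.
  let s : Setoid (Fin n) :=
    { r := fun i j => ∃ g, ρ g (b i) = b j
      iseqv :=
        ⟨fun i => ⟨1, by simp⟩, fun {i j} ⟨g, hg⟩ => ⟨g⁻¹, by simp [← hg]⟩,
          fun {i j k} ⟨g, hg⟩ ⟨g', hg'⟩ => ⟨g' * g, by simp [hg, hg']⟩⟩ }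
  let S : V →ₗ[R] (Quotient s →₀ R) := b.constr R fun i => Finsupp.single ⟦i⟧ 1
  let T : (Quotient s →₀ R) →ₗ[R] V := Finsupp.linearCombination R fun q => b q.out
  have hS : ∀ g, S ∘ₗ ρ g = S := by
    intro g
    refine b.ext fun i => ?_
    obtain ⟨j, hj⟩ := hb g i
    have : (⟦i⟧ : Quotient s) = ⟦j⟧ := Quotient.sound ⟨g, hj⟩
    simp [S, hj, this]
  have hT : ∀ x, T (S x) - x ∈ Representation.Coinvariants.ker ρ := by
    intro x
    have h1 : LinearMap.range (T ∘ₗ S - LinearMap.id) ≤ Representation.Coinvariants.ker ρ := by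
      rw [LinearMap.range_eq_map, ← b.span_eq, Submodule.map_span, Submodule.span_le]
      rintro _ ⟨_, ⟨i, rfl⟩, rfl⟩
      obtain ⟨g, hg⟩ : ∃ g, ρ g (b i) = b (Quotient.out (⟦i⟧ : Quotient s)) :=
        Quotient.exact (Quotient.out_eq (⟦i⟧ : Quotient s)).symm
      have := Representation.Coinvariants.sub_mem_ker (ρ := ρ) g (b i)
      simpa [S, T, ← hg] using this
    exact h1 ⟨x, rfl⟩
  have h0 : S v = 0 := by
    -- `S` is invariant under `G`, so it turns the norm into multiplication by `|G|`, which is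
    -- injective on a free module in characteristic zero.
    have h1 : S (ρ.norm v) = (Fintype.card G : R) • S v := by
      simp only [Representation.norm, LinearMap.sum_apply, map_sum]
      have : ∀ g, S (ρ g v) = S v := fun g => LinearMap.congr_fun (hS g) v
      simp [this, Nat.cast_smul_eq_nsmul]
    rw [hv, map_zero, eq_comm, smul_eq_zero] at h1
    exact h1.resolve_left (by exact_mod_cast Fintype.card_ne_zero)
  simpa [h0] using hT v

variable {p : ℕ} [hp : Fact p.Prime] {C : Type*} [CommGroup C] [Fintype C]

/-- For a group generated by `c`, the elements `g x - x` are of the form `c y - y`. -/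
theorem mem_range_sub_one {R G V : Type*} [CommRing R] [Group G] [AddCommGroup V] [Module R V]
    [Finite G] (ρ : Representation R G V) {c : G} (hc : ∀ g, g ∈ Subgroup.zpowers c) {v : V}
    (hv : v ∈ Representation.Coinvariants.ker ρ) : ∃ y, ρ c y - y = v := by
  suffices h : Representation.Coinvariants.ker ρ ≤ LinearMap.range (ρ c - 1) by
    obtain ⟨y, hy⟩ := h hv
    exact ⟨y, by simpa using hy⟩
  rw [Representation.Coinvariants.ker, Submodule.span_le]
  rintro _ ⟨⟨g, x⟩, rfl⟩
  classical
  obtain ⟨n, rfl⟩ := (mem_zpowers_iff_mem_range_orderOf.1 (hc g) |> Finset.mem_image.1).imp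
    fun _ h => h.2
  obtain ⟨q, hq⟩ := sub_one_dvd_pow_sub_one (ρ c) n
  refine ⟨q x, ?_⟩
  have := LinearMap.congr_fun hq x
  simp at this
  simp [this]

variable {M : Type*} [AddCommGroup M] [Module ℤ_[p] M]

/-- An automorphism `f` with `f ^ p = 1` is unipotent modulo `p`, so that no non-zero submodule `K`
of a lattice satisfies `K ⊆ (f - 1) K`. -/
theorem eq_zero_of_eq_range_sub_one [Module.Free ℤ_[p] M] [Module.Finite ℤ_[p] M] (f : Module.End ℤ_[p] M)
    (hf : f ^ p = 1) (K : Submodule ℤ_[p] M) (hK : K ≤ K.map (f - 1)) : K = ⊥ := by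
  have h1 : ∀ n : ℕ, K ≤ K.map ((f - 1) ^ n) := by
    intro n
    induction n with
    | zero => simp [Module.End.one_eq_id]
    | succ n ih =>
      rw [pow_succ', Module.End.mul_eq_comp, Submodule.map_comp]
      exact hK.trans (Submodule.map_mono ih)
  -- Modulo `p`, `(f - 1)^p` is `f^p - 1 = 0`. For `p = 2` the sign is wrong, and `f^p + 1 = 2` is
  -- itself the missing multiple of `p`.
  obtain ⟨r, hr⟩ : ∃ r, (f - 1) ^ p = (p : Module.End ℤ_[p] M) * r := by
    obtain ⟨r, hr⟩ := (Commute.neg_one_right f).exists_add_pow_prime_eq hp.out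
    rcases hp.out.eq_two_or_odd' with h2 | ho
    · refine ⟨1 - f * r, ?_⟩
      have h3 : ((p : ℕ) : Module.End ℤ_[p] M) = 1 + 1 := by
        rw [one_add_one_eq_two]; exact_mod_cast congrArg (Nat.cast (R := Module.End ℤ_[p] M)) h2
      have h4 : (-1 : Module.End ℤ_[p] M) ^ p = 1 := Even.neg_one_pow (h2 ▸ even_two)
      rw [sub_eq_add_neg, hr, hf, h4, mul_sub, mul_one, mul_assoc, mul_assoc, ← mul_assoc f]
      simp [h3, sub_eq_add_neg]
    · refine ⟨-f * r, ?_⟩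
      rw [sub_eq_add_neg, hr, hf, ho.neg_one_pow]
      simp [mul_assoc]
  -- Krull's intersection theorem: iterating the hypothesis gives `K ⊆ (f - 1)^(pn) K ⊆ p^n M` for
  -- every `n`.
  have h2 := Ideal.iInf_pow_smul_eq_bot_of_isLocalRing (M := M)
    (Ideal.span {(p : ℤ_[p])}) (by
      rw [← PadicInt.maximalIdeal_eq_span_p]; exact (IsLocalRing.maximalIdeal.isMaximal _).ne_top)
  rw [eq_bot_iff, ← h2]
  refine le_iInf fun n x hx => ?_
  obtain ⟨y, -, rfl⟩ := h1 (p * n) hx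
  rw [pow_mul, hr, (Nat.cast_commute p r).mul_pow, Ideal.span_singleton_pow]
  refine Submodule.smul_mem_smul (r := (p : ℤ_[p]) ^ n) (n := (r ^ n) y)
    (Ideal.mem_span_singleton_self _) Submodule.mem_top |> fun h => ?_
  convert h using 1
  rw [← Nat.cast_pow, Module.End.mul_apply, Module.End.natCast_apply, ← Nat.cast_pow,
    Nat.cast_smul_eq_nsmul]

/-- A lattice for a group `C` of order `p` is a permutation module if its first cohomology
vanishes. -/
theorem isPermutationModule_of_norm [Module.Free ℤ_[p] M] [Module.Finite ℤ_[p] M]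
    (hC : Nat.card C = p) {c : C} (ρ : Representation ℤ_[p] C M)
    (h : ∀ x, ρ.norm x = 0 → ∃ y, ρ c y - y = x) (hc : ∀ g, g ∈ Subgroup.zpowers c) :
    IsPermutationModule ρ := by
  induction hn : Module.finrank ℤ_[p] M using Nat.strong_induction_on generalizing M with
  | _ n ih =>
  have hexp : ∀ g : C, g ^ p = 1 := fun g => by rw [← hC]; exact pow_card_eq_one'
  by_cases hs : HasDirectSummand ρ (Representation.leftRegular ℤ_[p] C)
  · obtain ⟨A, B, hAB, ⟨e⟩⟩ := hs
    have hAB' : IsCompl A.toSubmodule B.toSubmodule := by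
      constructor
      · rw [disjoint_iff, ← Subrepresentation.toSubmodule_inf, hAB.inf_eq_bot]; rfl
      · rw [codisjoint_iff, ← Subrepresentation.toSubmodule_sup, hAB.sup_eq_top]; rfl
    refine .of_isCompl hAB' (.of_equiv e .leftRegular) (ih _ ?_ _ ?_ rfl)
    · have h1 := (Submodule.prodEquivOfIsCompl _ _ hAB').finrank_eq
      have h2 : Module.finrank ℤ_[p] A.toSubmodule = Fintype.card C := by
        rw [e.toLinearEquiv.finrank_eq, (MonoidAlgebra.coeffLinearEquiv ℤ_[p]).finrank_eq,
          Module.finrank_finsupp_self]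
      have h3 : 0 < Fintype.card C := Fintype.card_pos
      rw [Module.finrank_prod] at h1
      omega
    · intro x hx
      have hx' : ρ.norm x.1 = 0 := by
        simpa [Representation.norm, LinearMap.sum_apply] using! congrArg Subtype.val hx
      obtain ⟨y, hy⟩ := h _ hx'
      obtain ⟨⟨a, b⟩, rfl⟩ := (Submodule.prodEquivOfIsCompl _ _ hAB').surjective y
      -- The `B`-component of the solution in the whole lattice still works: the error lies in both
      -- `A` and `B`.
      refine ⟨b, Subtype.ext ?_⟩
      change ρ c b.1 - b.1 = x.1
      have h1 : ρ c b.1 - b.1 - x.1 = -(ρ c a.1 - a.1) := by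
        rw [← hy]
        simp only [Submodule.coe_prodEquivOfIsCompl', map_add]
        abel
      have hA : ρ c b.1 - b.1 - x.1 ∈ A.toSubmodule := by
        rw [h1]
        exact neg_mem (sub_mem (A.apply_mem_toSubmodule c a.2) a.2)
      have hB : ρ c b.1 - b.1 - x.1 ∈ B.toSubmodule :=
        sub_mem (sub_mem (B.apply_mem_toSubmodule c b.2) b.2) x.2
      exact sub_eq_zero.1 (Submodule.disjoint_def.1 hAB'.disjoint _ hA hB)
  · have hK : LinearMap.range (ρ c - 1) = ⊥ := by
      refine eq_zero_of_eq_range_sub_one (ρ c) (by rw [← map_pow, hexp, map_one]) _ ?_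
      rintro _ ⟨y, rfl⟩
      obtain ⟨w, hw⟩ := norm_mem_of_no_free ρ hexp hs y
      have hp0 : (p : ℤ_[p]) ≠ 0 := by exact_mod_cast hp.out.ne_zero
      -- `p w` is a norm, hence fixed, and the lattice is torsion-free.
      have hwg : ∀ g, ρ g w = w := by
        intro g
        apply smul_right_injective M hp0
        change (p : ℤ_[p]) • ρ g w = (p : ℤ_[p]) • w
        rw [← map_smul, ← hw, ρ.self_norm_apply]
      have hw' : ρ.norm w = (p : ℤ_[p]) • w := by
        rw [Representation.norm, LinearMap.sum_apply, Finset.sum_congr rfl fun g _ => hwg g]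
        rw [Finset.sum_const, Finset.card_univ, ← Nat.card_eq_fintype_card, hC,
          Nat.cast_smul_eq_nsmul]
      -- Since `w` is fixed, `(c - 1)y = (c - 1)(y - w) = (c - 1)²z`.
      obtain ⟨z, hz⟩ := h (y - w) (by rw [map_sub, hw, hw', sub_self])
      refine ⟨(ρ c - 1) z, ⟨z, rfl⟩, ?_⟩
      have : (ρ c - 1) z = y - w := hz
      rw [this, map_sub, sub_eq_self]
      simp [hwg]
    have hc1 : ρ c = 1 := sub_eq_zero.1 (LinearMap.range_eq_bot.1 hK)
    refine .of_basis (Module.Free.chooseBasis ℤ_[p] M) fun g i => ⟨i, ?_⟩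
    obtain ⟨k, rfl⟩ := mem_powers_iff_mem_zpowers.2 (hc g)
    simp [map_pow, hc1]

end PrimeOrder

/-! ### Splitting off a summand `Λ_(N)` -/

section Splitting

/-- If `f ∘ s` is bijective, then `V` is the direct sum of the image of `s` and the kernel of `f`.
Requiring only bijectivity, not `f ∘ s = id`, allows a composite that is multiplication by a unit.
-/
theorem HasDirectSummand.of_bijective {R G V W : Type*} [CommRing R] [Group G]
    [AddCommGroup V] [Module R V] [AddCommGroup W] [Module R W]
    {ρ : Representation R G V} {σ : Representation R G W} (s : W →ₗ[R] V) (f : V →ₗ[R] W)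
    (hs : ∀ g x, s (σ g x) = ρ g (s x)) (hf : ∀ g x, f (ρ g x) = σ g (f x))
    (h : Function.Bijective (f ∘ₗ s)) : HasDirectSummand ρ σ := by
  have hinj : Function.Injective s := fun x y hxy => h.1 (congrArg f hxy)
  refine ⟨⟨LinearMap.range s, ?_⟩, ⟨LinearMap.ker f, ?_⟩, ⟨?_, ?_⟩, ⟨?_⟩⟩
  · rintro g _ ⟨x, rfl⟩
    exact ⟨_, hs g x⟩
  · intro g x hx
    rw [LinearMap.mem_ker] at hx ⊢
    rw [hf, hx, map_zero]
  · rw [disjoint_iff]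
    apply Subrepresentation.toSubmodule_injective
    rw [Subrepresentation.toSubmodule_inf]
    change LinearMap.range s ⊓ LinearMap.ker f = ⊥
    rw [eq_bot_iff]
    rintro _ ⟨⟨x, rfl⟩, hx⟩
    have hx' : (f ∘ₗ s) x = (f ∘ₗ s) 0 := by rw [map_zero]; exact hx
    simp [h.1 hx']
  · rw [codisjoint_iff]
    apply Subrepresentation.toSubmodule_injective
    rw [Subrepresentation.toSubmodule_sup]
    change LinearMap.range s ⊔ LinearMap.ker f = ⊤
    rw [eq_top_iff]
    intro x _
    obtain ⟨y, hy⟩ := h.2 (f x)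
    refine Submodule.mem_sup.2 ⟨s y, ⟨_, rfl⟩, x - s y, ?_, by abel⟩
    rw [LinearMap.mem_ker, map_sub, ← hy, LinearMap.comp_apply, sub_self]
  · refine Representation.Equiv.symm (Representation.Equiv.mk (LinearEquiv.ofInjective s hinj) ?_)
    intro g
    ext x
    exact hs g x

/-- A vector outside `p L` has a coordinate outside the maximal ideal, so a coordinate function
serves. -/
theorem exists_isUnit_functional {p : ℕ} [Fact p.Prime] {L : Type*} [AddCommGroup L]
    [Module ℤ_[p] L] [Module.Free ℤ_[p] L] [Module.Finite ℤ_[p] L] {v : L}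
    (hv : ¬ ∃ w, v = (p : ℤ_[p]) • w) : ∃ φ : L →ₗ[ℤ_[p]] ℤ_[p], IsUnit (φ v) := by
  let b := Module.Free.chooseBasis ℤ_[p] L
  by_contra! hcon
  have h1 : ∀ i, ∃ c, b.repr v i = (p : ℤ_[p]) * c := by
    intro i
    have h2 := (IsLocalRing.mem_maximalIdeal _).2 (hcon (b.coord i))
    rwa [PadicInt.maximalIdeal_eq_span_p, Ideal.mem_span_singleton] at h2
  choose c hc using h1
  refine hv ⟨∑ i, c i • b i, ?_⟩
  rw [Finset.smul_sum]
  conv_lhs => rw [← b.sum_repr v]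
  exact Finset.sum_congr rfl fun i _ => by rw [hc, mul_smul]

/-- Abel summation. When `x^n = 1` and the powers of `x` sum to zero, it shows that `x - 1` divides
`n`, with an explicit cofactor. -/
theorem sub_one_mul_sum_natCast_mul_pow {R : Type*} [Ring R] (x : R) (n : ℕ) :
    (x - 1) * ∑ l ∈ Finset.range n, (l : R) * x ^ l =
      n * x ^ n - x * ∑ l ∈ Finset.range n, x ^ l := by
  induction n with
  | zero => simp
  | succ n ih =>
    have h : (x - 1) * (n * x ^ n) = n * x ^ (n + 1) - n * x ^ n := by
      rw [sub_mul, one_mul, ← mul_assoc, ← (Nat.cast_commute n x).eq, mul_assoc, ← pow_succ']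
    rw [Finset.sum_range_succ, Finset.sum_range_succ, mul_add, mul_add, ih, h, ← pow_succ']
    push_cast
    rw [add_mul, one_mul]
    abel

/-- Each `f l` occurs in exactly `n - l` of the partial sums. -/
theorem sum_partial_sums_add {R : Type*} [CommRing R] (f : ℕ → R) (n : ℕ) :
    ∑ j ∈ Finset.range n, ∑ l ∈ Finset.range (j + 1), f l + ∑ l ∈ Finset.range n, l * f l =
      n * ∑ l ∈ Finset.range n, f l := by
  induction n with
  | zero => simp
  | succ n ih =>
    rw [Finset.sum_range_succ _ n, Finset.sum_range_succ (fun l : ℕ => (l : R) * f l)]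
    rw [Finset.sum_range_succ f n]
    push_cast
    linear_combination ih

section PartialSums

variable {R L P : Type*} [CommRing R] [AddCommGroup L] [Module R L] [AddCommGroup P] [Module R P]

/-- The map `x ↦ ∑_{j < n} (∑_{l ≤ j} φ (T^l x)) S^j e`. -/
def partialSumMap (φ : L →ₗ[R] R) (T : Module.End R L) (S : Module.End R P) (e : P) (n : ℕ) :
    L →ₗ[R] P :=
  ∑ j ∈ Finset.range n, (∑ l ∈ Finset.range (j + 1), φ ∘ₗ T ^ l).smulRight ((S ^ j) e)

theorem partialSumMap_apply (φ : L →ₗ[R] R) (T : Module.End R L) (S : Module.End R P) (e : P)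
    (n : ℕ) (x : L) : partialSumMap φ T S e n x =
      ∑ j ∈ Finset.range n, (∑ l ∈ Finset.range (j + 1), φ ((T ^ l) x)) • (S ^ j) e := by
  simp [partialSumMap, LinearMap.sum_apply]

theorem partialSumMap_equivariant (φ : L →ₗ[R] R) (T : Module.End R L) (S : Module.End R P) (e : P)
    (n : ℕ) (hT : ∑ j ∈ Finset.range n, T ^ j = 0) (hS : ∑ j ∈ Finset.range n, (S ^ j) e = 0)
    (x : L) : partialSumMap φ T S e n x = S (partialSumMap φ T S e n (T x)) := by
  have h1 : ∀ j, ∑ l ∈ Finset.range (j + 1), φ ((T ^ l) x) =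
      ∑ l ∈ Finset.range j, φ ((T ^ l) (T x)) + φ x := by
    intro j
    rw [Finset.sum_range_succ']
    simp [pow_succ]
  have h2 : ∑ l ∈ Finset.range n, φ ((T ^ l) (T x)) = 0 := by
    rw [← map_sum, ← LinearMap.sum_apply, hT, LinearMap.zero_apply, map_zero]
  rw [partialSumMap_apply, partialSumMap_apply, map_sum]
  simp only [h1, add_smul, map_smul]
  rw [Finset.sum_add_distrib, ← Finset.smul_sum, hS, smul_zero, add_zero]
  -- Index shift: the `j = 0` term is an empty sum, and the `j = n` term vanishes by `h2`.
  have h3 := Finset.sum_range_succ'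
    (fun j => (∑ l ∈ Finset.range j, φ ((T ^ l) (T x))) • (S ^ j) e) n
  rw [Finset.sum_range_succ, h2] at h3
  simp only [zero_smul, add_zero, Finset.range_zero, Finset.sum_empty] at h3
  rw [h3]
  simp only [pow_succ', Module.End.mul_apply]

end PartialSums

end Splitting

/-! ### Identities between the idempotents -/

section Identities

variable {p : ℕ} [hp : Fact p.Prime] {G : Type*} [CommGroup G] [Fintype G]

theorem single_mul_hat (H : Subgroup G) {h : G} (hh : h ∈ H) :
    MonoidAlgebra.single h 1 * hat p H = hat p H := by
  classical
  ext x
  rw [MonoidAlgebra.coeff_single_mul_apply, coeff_hat, coeff_hat, one_mul,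
    Subgroup.mul_mem_cancel_left _ (inv_mem hh)]

theorem hat_mul_of_forall (H : Subgroup G) {y : MonoidAlgebra ℚ_[p] G}
    (hy : ∀ h ∈ H, MonoidAlgebra.single h 1 * y = y) :
    hat p H * y = (Nat.card H : ℚ_[p]) • y := by
  classical
  rw [hat, Finset.sum_mul, Finset.sum_congr rfl fun g hg => hy g (Finset.mem_filter.1 hg).2,
    Finset.sum_const, Nat.cast_smul_eq_nsmul, ← Fintype.card_subtype, Nat.card_eq_fintype_card]

theorem hat_mul_hat_top (H : Subgroup G) : hat p H * hat p ⊤ = (Nat.card H : ℚ_[p]) • hat p ⊤ :=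
  hat_mul_of_forall H fun _ _ => single_mul_hat ⊤ trivial

theorem single_mul_idem_zero (g : G) :
    MonoidAlgebra.single g 1 * idem p (.zero : Index p G) = idem p .zero := by
  rw [idem, mul_smul_comm, single_mul_hat _ (Subgroup.mem_top g)]

theorem single_mul_idem_sub {H : Subgroup G} (hH : Nat.card H = p) {g : G} (hg : g ∈ H) :
    MonoidAlgebra.single g 1 * idem p (.sub H hH) = idem p (.sub H hH) := by
  rw [idem, mul_smul_comm, mul_sub, mul_smul_comm, single_mul_hat H hg,
    single_mul_hat _ (Subgroup.mem_top g)]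

theorem hat_top_mul_idem_sub (hG : Nat.card G = p ^ 2) {H : Subgroup G} (hH : Nat.card H = p) :
    hat p ⊤ * idem p (.sub H hH) = 0 := by
  rw [idem, mul_smul_comm, mul_sub, mul_smul_comm, mul_comm _ (hat p H), hat_mul_hat_top,
    hat_mul_hat_top, Subgroup.card_top, hG, hH, smul_smul]
  simp [sq]

theorem idem_sub_mul_idem_sub (hG : Nat.card G = p ^ 2) {H : Subgroup G} (hH : Nat.card H = p) :
    idem p (.sub H hH) * idem p (.sub H hH) = idem p (.sub H hH) := by
  have hp0 : (p : ℚ_[p]) ≠ 0 := by exact_mod_cast hp.out.ne_zero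
  have e : idem p (.sub H hH) = (1 / (p : ℚ_[p]) ^ 2) • ((p : ℚ_[p]) • hat p H - hat p ⊤) := rfl
  nth_rewrite 1 [e]
  rw [smul_mul_assoc, sub_mul, hat_top_mul_idem_sub hG, sub_zero, smul_mul_assoc,
    hat_mul_of_forall H fun _ h => single_mul_idem_sub hH h, hH, smul_smul, smul_smul]
  have : 1 / (p : ℚ_[p]) ^ 2 * p * p = 1 := by field_simp
  rw [this, one_smul]

theorem idem_zero_add_idem_sub {H : Subgroup G} (hH : Nat.card H = p) :
    idem p .zero + idem p (.sub H hH) = (p : ℚ_[p])⁻¹ • hat p H := by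
  have hp0 : (p : ℚ_[p]) ≠ 0 := by exact_mod_cast hp.out.ne_zero
  rw [idem, idem, ← smul_add, add_sub_cancel, smul_smul]
  congr 1
  field_simp

/-- The product is fixed by `c` and by `H`, hence by `G`, so `Ĝ` multiplies it by `p²`. But `Ĝ e_H =
0`. -/
theorem sum_single_pow_mul_idem_sub (hG : Nat.card G = p ^ 2) (hexp : ∀ g : G, g ^ p = 1)
    {H : Subgroup G} (hH : Nat.card H = p) {c : G}
    (hc : ∀ g, ∃ h ∈ H, ∃ j : ℕ, g = h * c ^ j) :
    (∑ j ∈ Finset.range p, MonoidAlgebra.single (c ^ j) 1) * idem p (.sub H hH) = 0 := by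
  have hp0 : (p : ℚ_[p]) ≠ 0 := by exact_mod_cast hp.out.ne_zero
  set y := (∑ j ∈ Finset.range p, MonoidAlgebra.single (c ^ j) 1) * idem p (.sub H hH) with hy
  have h1 : MonoidAlgebra.single c 1 * y = y := by
    rw [hy, ← mul_assoc, Finset.mul_sum]
    congr 1
    have := Finset.sum_range_succ' (fun j => MonoidAlgebra.single (c ^ j) (1 : ℚ_[p])) p
    rw [Finset.sum_range_succ, hexp, pow_zero, add_left_inj] at this
    rw [this]
    exact Finset.sum_congr rfl fun j _ => by rw [MonoidAlgebra.single_mul_single, pow_succ', one_mul]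
  have h2 : ∀ g ∈ (⊤ : Subgroup G), MonoidAlgebra.single g 1 * y = y := by
    rintro g -
    obtain ⟨h, hh, j, rfl⟩ := hc g
    have h3 : ∀ j : ℕ, MonoidAlgebra.single (c ^ j) 1 * y = y := by
      intro j
      induction j with
      | zero => rw [pow_zero, ← MonoidAlgebra.one_def, one_mul]
      | succ j ih =>
        rw [pow_succ, ← one_mul (1 : ℚ_[p]), ← MonoidAlgebra.single_mul_single, mul_assoc, h1, ih]
    rw [← one_mul (1 : ℚ_[p]), ← MonoidAlgebra.single_mul_single, mul_assoc, h3, hy, mul_left_comm,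
      single_mul_idem_sub hH hh]
  have h3 := hat_mul_of_forall ⊤ h2
  rw [hy, mul_left_comm, hat_top_mul_idem_sub hG, mul_zero, ← hy, Subgroup.card_top, hG, eq_comm,
    smul_eq_zero] at h3
  exact h3.resolve_left (by exact_mod_cast pow_ne_zero 2 hp.out.ne_zero)

end Identities

/-! ### The action of the idempotents on `ℚ_p ⊗ U`, and the lattices `U_(i)` -/

section Summand

variable {p : ℕ} [hp : Fact p.Prime] {G : Type*} [CommGroup G] [Fintype G]
  {U : Type*} [AddCommGroup U] [Module ℤ_[p] U] (ρ : Representation ℤ_[p] G U)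

theorem coe_lambdaRep (i : Index p G) (g : G) (y : (lambdaSub p i).toSubmodule) :
    (lambdaRep p i g y).1 = MonoidAlgebra.single g 1 * y.1 := by
  change Representation.leftRegular ℚ_[p] G g y.1 = _
  rw [← Representation.asAlgebraHom_ofMulAction_smul_eq_mul,
    Representation.asAlgebraHom_single, one_smul]

theorem ratRep_asAlgebraHom_inclRat (a : MonoidAlgebra ℤ_[p] G) (u : U) :
    (ratRep ρ).asAlgebraHom (inclRat p G a) (1 ⊗ₜ u) = (1 : ℚ_[p]) ⊗ₜ ρ.asAlgebraHom a u := by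
  rw [← intRep_asAlgebraHom]
  induction a using MonoidAlgebra.induction_linear with
  | zero => simp
  | add x y hx hy => simp only [map_add, LinearMap.add_apply, hx, hy, TensorProduct.tmul_add]
  | single g r => simp [Representation.asAlgebraHom_single, restrictToInt, ratRep]

theorem ratRep_eq_asAlgebraHom (g : G) (w : ℚ_[p] ⊗[ℤ_[p]] U) :
    ratRep ρ g w = (ratRep ρ).asAlgebraHom (MonoidAlgebra.single g 1) w := by
  simp

theorem asAlgebraHom_mul_apply {R V : Type*} [CommRing R] [AddCommGroup V] [Module R V]
    (σ : Representation R G V) (a b : MonoidAlgebra R G) (v : V) :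
    σ.asAlgebraHom a (σ.asAlgebraHom b v) = σ.asAlgebraHom (a * b) v := by
  rw [map_mul, Module.End.mul_apply]

theorem idem_sub_apply_of_mem (hG : Nat.card G = p ^ 2) {H : Subgroup G} {hH : Nat.card H = p}
    {x : ℚ_[p] ⊗[ℤ_[p]] U} (hx : x ∈ (compSub ρ (.sub H hH)).toSubmodule) :
    (ratRep ρ).asAlgebraHom (idem p (.sub H hH)) x = x := by
  obtain ⟨w, -, rfl⟩ := hx
  simp only [LinearMap.coe_restrictScalars]
  rw [asAlgebraHom_mul_apply, idem_sub_mul_idem_sub hG]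

instance [Module.Finite ℤ_[p] U] (i : Index p G) :
    Module.Finite ℤ_[p] (compSub ρ i).toSubmodule :=
  Module.Finite.iff_fg.2 (Submodule.FG.map _ (Module.Finite.iff_fg.1
    (Module.Finite.range (TensorProduct.mk ℤ_[p] ℚ_[p] U 1))))

instance [Module.Finite ℤ_[p] U] (i : Index p G) :
    Module.Free ℤ_[p] (compSub ρ i).toSubmodule := by
  have : Module.IsTorsionFree ℤ_[p] (ℚ_[p] ⊗[ℤ_[p]] U) := .trans_faithfulSMul ℤ_[p] ℚ_[p] _
  infer_instance

end Summand

/-! ### Elements of `U` fixed by `e_H`, and summands `Λ_(H)` -/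

section SplitLambda

variable {p : ℕ} [hp : Fact p.Prime] {G : Type*} [CommGroup G] [Fintype G]
  {U : Type*} [AddCommGroup U] [Module ℤ_[p] U] (ρ : Representation ℤ_[p] G U)

/-- The class of `1` in `Λ_(i)`. -/
def lambdaOne (i : Index p G) : (lambdaSub p i).toSubmodule := ⟨lambdaMap p i 1, 1, rfl⟩

theorem coe_lambdaOne (i : Index p G) : (lambdaOne i).1 = idem p i := by
  simp [lambdaOne, lambdaMap]

/-- `Λ_(i)` is spanned over `ℤ_p` by the translates of `e_i`. -/
theorem lambda_linearMap_ext {i : Index p G} {P : Type*} [AddCommGroup P] [Module ℤ_[p] P]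
    {f g : (lambdaSub p i).toSubmodule →ₗ[ℤ_[p]] P}
    (h : ∀ x : G, f (lambdaRep p i x (lambdaOne i)) = g (lambdaRep p i x (lambdaOne i))) :
    f = g := by
  let q : MonoidAlgebra ℤ_[p] G →ₗ[ℤ_[p]] (lambdaSub p i).toSubmodule :=
    (lambdaMap p i).codRestrict _ fun b => ⟨b, rfl⟩
  suffices hq : ∀ b, f (q b) = g (q b) by
    ext ⟨_, b, rfl⟩
    exact hq b
  intro b
  induction b using MonoidAlgebra.induction_linear with
  | zero => simp only [map_zero]
  | add x y hx hy => simp only [map_add, hx, hy]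
  | single x r =>
    have : q (MonoidAlgebra.single x r) = r • lambdaRep p i x (lambdaOne i) := by
      rw [← mul_one r, ← smul_eq_mul, ← MonoidAlgebra.smul_single, map_smul, smul_eq_mul, mul_one]
      congr 1
      apply Subtype.ext
      rw [coe_lambdaRep, coe_lambdaOne]
      change idem p i * inclRat p G _ = _
      simp [inclRat, mul_comm]
    rw [this, map_smul, map_smul, h]

/-- Multiplication by an element of `ℤ_p G` on `Λ_(i)`. -/
def lambdaMul (i : Index p G) (a : MonoidAlgebra ℤ_[p] G) :
    (lambdaSub p i).toSubmodule →ₗ[ℤ_[p]] (lambdaSub p i).toSubmodule :=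
  ((LinearMap.mulLeft ℚ_[p] (inclRat p G a)).restrictScalars ℤ_[p]).restrict (by
    rintro _ ⟨b, rfl⟩
    exact ⟨a * b, by simp [lambdaMap, mul_left_comm]⟩)

theorem coe_lambdaMul (i : Index p G) (a : MonoidAlgebra ℤ_[p] G)
    (y : (lambdaSub p i).toSubmodule) : (lambdaMul i a y).1 = inclRat p G a * y.1 := rfl

theorem bijective_lambdaMul (i : Index p G) {a : MonoidAlgebra ℤ_[p] G} (ha : IsUnit a) :
    Function.Bijective (lambdaMul i a) := by
  obtain ⟨u, rfl⟩ := ha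
  refine Function.bijective_iff_has_inverse.2 ⟨lambdaMul i ↑u⁻¹, fun y => ?_, fun y => ?_⟩ <;>
  · apply Subtype.ext
    rw [coe_lambdaMul, coe_lambdaMul, ← mul_assoc, ← map_mul]
    simp

theorem sum_pow_compSub_eq_zero (hG : Nat.card G = p ^ 2) (hexp : ∀ g : G, g ^ p = 1)
    {H : Subgroup G} (hH : Nat.card H = p) {c : G} (hc : ∀ g, ∃ h ∈ H, ∃ j : ℕ, g = h * c ^ j) :
    ∑ j ∈ Finset.range p, (compSub ρ (.sub H hH)).toRepresentation c ^ j = 0 := by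
  ext x
  rw [LinearMap.sum_apply, AddSubmonoidClass.coe_finsetSum]
  obtain ⟨_, w, -, rfl⟩ := x
  have h : ∀ j ∈ Finset.range p, (((compSub ρ (.sub H hH)).toRepresentation c ^ j)
      ⟨((ratRep ρ).asAlgebraHom (idem p (.sub H hH))) w, _, ‹_›, rfl⟩).1 =
      (ratRep ρ).asAlgebraHom (MonoidAlgebra.single (c ^ j) 1 * idem p (.sub H hH)) w := by
    intro j _
    rw [← map_pow, ← asAlgebraHom_mul_apply, ← ratRep_eq_asAlgebraHom]
    rfl
  refine (Finset.sum_congr rfl h).trans ?_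
  rw [← LinearMap.sum_apply, ← map_sum, ← Finset.sum_mul,
    sum_single_pow_mul_idem_sub hG hexp hH hc, map_zero]
  rfl

/-- If `H` acts trivially and `∑_j c^j` acts as zero on a lattice, there is an equivariant map to
`Λ_(H)` mapping a given element that is not divisible by `c - 1` to a generator. -/
theorem exists_map_lambda {L : Type*} [AddCommGroup L] [Module ℤ_[p] L] [Module.Free ℤ_[p] L]
    [Module.Finite ℤ_[p] L] (τ : Representation ℤ_[p] G L) (hG : Nat.card G = p ^ 2)
    (hexp : ∀ g : G, g ^ p = 1) {H : Subgroup G} (hH : Nat.card H = p) {c : G}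
    (hc : ∀ g, ∃ h ∈ H, ∃ j : ℕ, g = h * c ^ j) (hτ : ∀ h ∈ H, ∀ x, τ h x = x)
    (hT : ∑ j ∈ Finset.range p, τ c⁻¹ ^ j = 0) (k : L) (hk : ¬ ∃ x, τ c x - x = k) :
    ∃ (Ψ : L →ₗ[ℤ_[p]] (lambdaSub p (.sub H hH)).toSubmodule) (a : MonoidAlgebra ℤ_[p] G),
      IsUnit a ∧ (∀ g x, Ψ (τ g x) = lambdaRep p (.sub H hH) g (Ψ x)) ∧
      Ψ k = lambdaMul _ a (lambdaOne _) := by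
  set i : Index p G := .sub H hH
  have hcc : ∀ x, τ c (τ c⁻¹ x) = x := by
    intro x; rw [← Module.End.mul_apply, ← map_mul]; simp
  have hcc' : ∀ x, τ c⁻¹ (τ c x) = x := by
    intro x; rw [← Module.End.mul_apply, ← map_mul]; simp
  -- This `δ` is the cofactor of `c⁻¹ - 1` in `p`. So if `p` divided `δ k`, cancelling `p` would
  -- make `k` divisible by `c⁻¹ - 1`, hence by `c - 1`.
  set δ : Module.End ℤ_[p] _ := ∑ l ∈ Finset.range p, (l : Module.End ℤ_[p] _) * τ c⁻¹ ^ l with hδ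
  have hδp : ∀ x, τ c⁻¹ (δ x) - δ x = (p : ℤ_[p]) • x := by
    intro x
    have h := sub_one_mul_sum_natCast_mul_pow (τ c⁻¹) p
    rw [hT, mul_zero, ← map_pow τ, hexp, map_one, mul_one] at h
    have h2 := LinearMap.congr_fun h x
    rw [LinearMap.sub_apply, LinearMap.zero_apply, sub_zero] at h2
    rwa [Module.End.natCast_apply, ← Nat.cast_smul_eq_nsmul ℤ_[p]] at h2
  have hp0 : (p : ℤ_[p]) ≠ 0 := by exact_mod_cast hp.out.ne_zero
  have hv : ¬ ∃ w, δ k = (p : ℤ_[p]) • w := by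
    rintro ⟨w, hw⟩
    have h := hδp k
    rw [hw, map_smul, ← smul_sub] at h
    have h2 := smul_right_injective _ hp0 h
    refine hk ⟨-τ c⁻¹ w, ?_⟩
    rw [map_neg, hcc, ← h2]
    abel
  obtain ⟨φ, hφ⟩ := exists_isUnit_functional hv
  set S := lambdaRep p i c
  have hS : ∑ j ∈ Finset.range p, (S ^ j) (lambdaOne i) = 0 := by
    apply Subtype.ext
    rw [AddSubmonoidClass.coe_finsetSum]
    have : ∀ j ∈ Finset.range p, ((S ^ j) (lambdaOne i)).1 =
        MonoidAlgebra.single (c ^ j) 1 * idem p i := by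
      intro j _
      rw [← map_pow, coe_lambdaRep, coe_lambdaOne]
    refine (Finset.sum_congr rfl this).trans ?_
    rw [← Finset.sum_mul]
    exact sum_single_pow_mul_idem_sub hG hexp hH hc
  set Ψ := partialSumMap φ (τ c⁻¹) S (lambdaOne i) p
  -- The element `a` is read off from the formula for `Ψ k`. As `∑_l φ(c^(-l) k) = 0`, its
  -- augmentation is `-φ(δ k)`, a unit by the choice of `φ`, and this makes `a` a unit.
  refine ⟨Ψ, ∑ j ∈ Finset.range p, (∑ l ∈ Finset.range (j + 1), φ ((τ c⁻¹ ^ l) k)) •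
    MonoidAlgebra.single (c ^ j) 1, ?_, ?_, ?_⟩
  · apply isUnit_of_aug hexp
    have h1 : ∑ l ∈ Finset.range p, φ ((τ c⁻¹ ^ l) k) = 0 := by
      rw [← map_sum, ← LinearMap.sum_apply, hT, LinearMap.zero_apply, map_zero]
    have h2 := sum_partial_sums_add (fun l => φ ((τ c⁻¹ ^ l) k)) p
    have h3 : φ (δ k) = ∑ l ∈ Finset.range p, (l : ℤ_[p]) * φ ((τ c⁻¹ ^ l) k) := by
      rw [hδ, LinearMap.sum_apply, map_sum]
      refine Finset.sum_congr rfl fun l _ => ?_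
      rw [Module.End.mul_apply, Module.End.natCast_apply, map_nsmul, nsmul_eq_mul]
    rw [h1, mul_zero, ← h3] at h2
    have h4 : ∑ g : G, (∑ j ∈ Finset.range p, (∑ l ∈ Finset.range (j + 1), φ ((τ c⁻¹ ^ l) k)) •
        MonoidAlgebra.single (c ^ j) (1 : ℤ_[p])).coeff g =
        ∑ j ∈ Finset.range p, ∑ l ∈ Finset.range (j + 1), φ ((τ c⁻¹ ^ l) k) := by
      classical
      simp only [MonoidAlgebra.coeff_sum, Finsupp.finsetSum_apply]
      rw [Finset.sum_comm]
      refine Finset.sum_congr rfl fun j _ => ?_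
      simp [Finsupp.single_apply]
    rw [h4, eq_neg_of_add_eq_zero_left h2]
    exact hφ.neg
  · have h1 : ∀ x, Ψ (τ c x) = S (Ψ x) := by
      intro x
      have := partialSumMap_equivariant φ (τ c⁻¹) S (lambdaOne i) p hT hS (τ c x)
      rwa [hcc'] at this
    intro g x
    obtain ⟨h, hh, j, rfl⟩ := hc g
    have h3 : ∀ y, lambdaRep p i h y = y := by
      rintro ⟨_, b, rfl⟩
      apply Subtype.ext
      rw [coe_lambdaRep]
      change MonoidAlgebra.single h 1 * (idem p i * _) = idem p i * _
      rw [← mul_assoc, single_mul_idem_sub hH hh]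
    rw [map_mul, map_mul, Module.End.mul_apply, Module.End.mul_apply, hτ h hh, h3, map_pow, map_pow]
    induction j with
    | zero => simp
    | succ j ih => rw [pow_succ', pow_succ', Module.End.mul_apply, Module.End.mul_apply, h1, ih]
  · apply Subtype.ext
    rw [coe_lambdaMul, coe_lambdaOne, partialSumMap_apply, AddSubmonoidClass.coe_finsetSum,
      map_sum, Finset.sum_mul]
    refine Finset.sum_congr rfl fun j _ => ?_
    rw [Submodule.coe_smul, ← map_pow, coe_lambdaRep, coe_lambdaOne]
    generalize ∑ l ∈ Finset.range (j + 1), φ ((τ c⁻¹ ^ l) k) = r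
    rw [MonoidAlgebra.smul_single, smul_eq_mul, mul_one, inclRat, MonoidAlgebra.mapRingHom_single,
      ← algebraMap_smul ℚ_[p] r, ← smul_mul_assoc, MonoidAlgebra.smul_single, smul_eq_mul, mul_one]

/-- In a lattice without summands `Λ_(H)`, an element of `U ∩ e_H ℚ_p U` is divisible by `c - 1`
in `U_(H)`. -/
theorem exists_compSub_sub_eq [Module.Free ℤ_[p] U] [Module.Finite ℤ_[p] U]
    (hG : Nat.card G = p ^ 2) (hexp : ∀ g : G, g ^ p = 1) {H : Subgroup G} (hH : Nat.card H = p)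
    {c : G} (hc : ∀ g, ∃ h ∈ H, ∃ j : ℕ, g = h * c ^ j)
    (hred : ¬ HasDirectSummand ρ (lambdaRep p (.sub H hH))) {k : U}
    (hk : (ratRep ρ).asAlgebraHom (idem p (.sub H hH)) (1 ⊗ₜ k) = 1 ⊗ₜ k) :
    ∃ x ∈ (compSub ρ (.sub H hH)).toSubmodule, ratRep ρ c x - x = 1 ⊗ₜ k := by
  by_contra! hcon
  apply hred
  set i : Index p G := .sub H hH
  set ι := TensorProduct.mk ℤ_[p] ℚ_[p] U 1
  have hι : Function.Injective ι := Module.Flat.tensorProduct_mk_injective _ _ _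
  let k' : (compSub ρ i).toSubmodule := ⟨1 ⊗ₜ k, ι k, ⟨k, rfl⟩, hk⟩
  -- The vanishing sum of powers is needed for `c⁻¹`, which also generates `G` modulo `H`.
  have hc' : ∀ g, ∃ h ∈ H, ∃ j : ℕ, g = h * c⁻¹ ^ j := by
    intro g
    obtain ⟨h, hh, j, hj⟩ := hc g⁻¹
    exact ⟨h⁻¹, inv_mem hh, j, by rw [inv_pow, ← mul_inv, ← hj, inv_inv]⟩
  have hτ : ∀ h ∈ H, ∀ x, (compSub ρ i).toRepresentation h x = x := by
    rintro h hh ⟨_, w, hw, rfl⟩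
    apply Subtype.ext
    change ratRep ρ h ((ratRep ρ).asAlgebraHom (idem p i) w) =
      (ratRep ρ).asAlgebraHom (idem p i) w
    rw [ratRep_eq_asAlgebraHom, asAlgebraHom_mul_apply, single_mul_idem_sub hH hh]
  obtain ⟨Ψ, a, ha, hΨ, hΨk⟩ := exists_map_lambda (compSub ρ i).toRepresentation hG hexp hH hc hτ
    (sum_pow_compSub_eq_zero ρ hG hexp hH hc') k' (by
    rintro ⟨x, hx⟩
    exact hcon x.1 x.2 (congrArg Subtype.val hx))
  -- The map `y ↦ y k`. It lands in `U` because `(e_H b) k = b k` for `b ∈ ℤ_p G`, by `e_H k = k`.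
  let s' : (lambdaSub p i).toSubmodule →ₗ[ℤ_[p]] ℚ_[p] ⊗[ℤ_[p]] U :=
    ((LinearMap.applyₗ (1 ⊗ₜ k) ∘ₗ (ratRep ρ).asAlgebraHom.toLinearMap).restrictScalars ℤ_[p]) ∘ₗ
      (lambdaSub p i).toSubmodule.subtype
  have hs' : ∀ y, s' y = (ratRep ρ).asAlgebraHom y.1 (1 ⊗ₜ k) := fun y => rfl
  have hr : ∀ y, s' y ∈ LinearMap.range ι := by
    rintro ⟨_, b, rfl⟩
    refine ⟨ρ.asAlgebraHom b k, ?_⟩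
    rw [hs']
    change _ = (ratRep ρ).asAlgebraHom (idem p i * inclRat p G b) _
    rw [mul_comm, ← asAlgebraHom_mul_apply, hk, ratRep_asAlgebraHom_inclRat]
    rfl
  let s : (lambdaSub p i).toSubmodule →ₗ[ℤ_[p]] U :=
    (LinearEquiv.ofInjective ι hι).symm.toLinearMap ∘ₗ s'.codRestrict _ hr
  have hs : ∀ y, ι (s y) = s' y := fun y =>
    congrArg Subtype.val ((LinearEquiv.ofInjective ι hι).apply_symm_apply ⟨s' y, hr y⟩)
  have hιg : ∀ g u, ι (ρ g u) = ratRep ρ g (ι u) := fun g u => by simp [ι, ratRep]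
  let π : U →ₗ[ℤ_[p]] (compSub ρ i).toSubmodule :=
    (((ratRep ρ).asAlgebraHom (idem p i)).restrictScalars ℤ_[p] ∘ₗ ι).codRestrict _
      fun u => ⟨ι u, ⟨u, rfl⟩, rfl⟩
  have hπ : ∀ u, (π u).1 = (ratRep ρ).asAlgebraHom (idem p i) (ι u) := fun u => rfl
  have hsg : ∀ g y, s (lambdaRep p i g y) = ρ g (s y) := by
    intro g y
    apply hι
    rw [hιg, hs, hs, hs', hs', coe_lambdaRep, ratRep_eq_asAlgebraHom, asAlgebraHom_mul_apply]
  have hfg : ∀ g u, (Ψ ∘ₗ π) (ρ g u) = lambdaRep p i g ((Ψ ∘ₗ π) u) := by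
    intro g u
    rw [LinearMap.comp_apply, LinearMap.comp_apply, ← hΨ]
    congr 1
    apply Subtype.ext
    change _ = ratRep ρ g (π u).1
    rw [hπ, hπ, hιg, ratRep_eq_asAlgebraHom, ratRep_eq_asAlgebraHom, asAlgebraHom_mul_apply,
      asAlgebraHom_mul_apply, mul_comm]
  refine .of_bijective s (Ψ ∘ₗ π) hsg hfg ?_
  -- By equivariance it suffices to evaluate at `e_H`, which goes to `k` in `U`, then to `k` in
  -- `U_(H)`, then to `a e_H`.
  have : (Ψ ∘ₗ π) ∘ₗ s = lambdaMul i a := by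
    refine lambda_linearMap_ext fun g => ?_
    rw [LinearMap.comp_apply, hsg, hfg]
    have h1 : π (s (lambdaOne i)) = k' := by
      apply Subtype.ext
      rw [hπ, hs, hs', coe_lambdaOne, hk]
      exact hk
    rw [LinearMap.comp_apply, h1, hΨk]
    apply Subtype.ext
    simp only [coe_lambdaRep, coe_lambdaMul]
    rw [mul_left_comm]
  rw [this]
  exact bijective_lambdaMul i ha

end SplitLambda

/-! ### The cohomology of `U^N` and the diagram -/

section FixedPoints

variable {p : ℕ} [hp : Fact p.Prime] {G : Type*} [CommGroup G] [Fintype G]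
  {U : Type*} [AddCommGroup U] [Module ℤ_[p] U] (ρ : Representation ℤ_[p] G U)

theorem exists_quotient_generator (hG : Nat.card G = p ^ 2) {N : Subgroup G}
    (hN : Nat.card N = p) : ∃ c : G, Nat.card (G ⧸ N) = p ∧
      (∀ q : G ⧸ N, q ∈ Subgroup.zpowers (QuotientGroup.mk c : G ⧸ N)) ∧
      ∀ g, ∃ h ∈ N, ∃ j : ℕ, g = h * c ^ j := by
  have hcard : Nat.card (G ⧸ N) = p := by
    have h := N.card_eq_card_quotient_mul_card_subgroup
    rw [hG, hN, sq] at h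
    exact (Nat.eq_of_mul_eq_mul_right hp.out.pos h).symm
  have : IsCyclic (G ⧸ N) := isCyclic_of_prime_card hcard
  obtain ⟨q, hq⟩ := IsCyclic.exists_generator (α := G ⧸ N)
  obtain ⟨c, rfl⟩ := QuotientGroup.mk_surjective q
  refine ⟨c, hcard, hq, fun g => ?_⟩
  obtain ⟨j, hj⟩ := mem_powers_iff_mem_zpowers.2 (hq (QuotientGroup.mk g))
  refine ⟨g * (c ^ j)⁻¹, ?_, j, by simp⟩
  rw [mul_comm]
  exact QuotientGroup.eq.1 hj

/-- All `|N|` elements of a coset act in the same way on an `N`-fixed vector. Over `ℤ_p`, the two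
norms therefore vanish together on a lattice. -/
theorem nsmul_norm_quotientToInvariants {R V : Type*} [CommRing R] [AddCommGroup V] [Module R V]
    (σ : Representation R G V) (N : Subgroup G) [Fintype (G ⧸ N)]
    (m : Representation.invariants (σ.comp N.subtype)) :
    Nat.card N • ((σ.quotientToInvariants N).norm m).1 = σ.norm m.1 := by
  classical
  have h1 : ∀ g : G, σ g m.1 = (σ.quotientToInvariants N (QuotientGroup.mk g) m).1 :=
    fun g => rfl
  rw [Representation.norm, Representation.norm, LinearMap.sum_apply, LinearMap.sum_apply,
    AddSubmonoidClass.coe_finsetSum]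
  simp only [h1]
  rw [← Finset.sum_fiberwise _ (fun g : G => (QuotientGroup.mk g : G ⧸ N)), Finset.smul_sum]
  refine Finset.sum_congr rfl fun q _ => ?_
  rw [Finset.sum_congr rfl fun g hg => by rw [(Finset.mem_filter.1 hg).2], Finset.sum_const]
  congr 1
  have h2 := QuotientGroup.card_preimage_mk N {q}
  rw [Nat.card_unique (α := ({q} : Set (G ⧸ N))), mul_one] at h2
  rw [← h2, ← Fintype.card_subtype, ← Nat.card_eq_fintype_card]
  rfl

theorem mk_mem_quotSub_iff (i : Index p G) (v : (starSub ρ).toSubmodule) :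
    (Submodule.mkQ _ v : QuotV ρ) ∈ (quotSub ρ i).toSubmodule ↔
      ∃ y ∈ (compSub ρ i).toSubmodule, v.1 - y ∈ (latSub ρ).toSubmodule := by
  constructor
  · rintro ⟨y, hy, h⟩
    refine ⟨y.1, hy, ?_⟩
    exact (Submodule.Quotient.eq ((latSub ρ).toSubmodule.submoduleOf (starSub ρ).toSubmodule)).1 h.symm
  · rintro ⟨y, hy, h⟩
    refine ⟨⟨y, Submodule.mem_iSup_of_mem i hy⟩, hy, ?_⟩
    exact ((Submodule.Quotient.eq
      ((latSub ρ).toSubmodule.submoduleOf (starSub ρ).toSubmodule)).2 h).symm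

theorem mk_mem_invariants_iff (v : (starSub ρ).toSubmodule) (g : G) :
    quotRep ρ g (Submodule.mkQ _ v) = Submodule.mkQ _ v ↔
      ratRep ρ g v.1 - v.1 ∈ (latSub ρ).toSubmodule :=
  Submodule.Quotient.eq _

theorem asAlgebraHom_of_forall_fixed (H : Subgroup G) {w : ℚ_[p] ⊗[ℤ_[p]] U}
    (hw : ∀ h ∈ H, ratRep ρ h w = w) :
    (ratRep ρ).asAlgebraHom (hat p H) w = (Nat.card H : ℚ_[p]) • w := by
  classical
  rw [hat, map_sum, LinearMap.sum_apply, Nat.cast_smul_eq_nsmul]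
  simp only [← ratRep_eq_asAlgebraHom]
  rw [Finset.sum_congr rfl fun g hg => hw g (Finset.mem_filter.1 hg).2,
    Finset.sum_const, ← Fintype.card_subtype, Nat.card_eq_fintype_card]

variable {ρ}

theorem idem_sub_apply_of_fixed (hG : Nat.card G = p ^ 2) {H : Subgroup G} (hH : Nat.card H = p)
    {w : ℚ_[p] ⊗[ℤ_[p]] U} (hw : ∀ g, ratRep ρ g w = w) :
    (ratRep ρ).asAlgebraHom (idem p (.sub H hH)) w = 0 := by
  rw [idem, map_smul, map_sub, map_smul, LinearMap.smul_apply, LinearMap.sub_apply,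
    LinearMap.smul_apply, asAlgebraHom_of_forall_fixed ρ _ fun g _ => hw g,
    asAlgebraHom_of_forall_fixed ρ _ fun g _ => hw g, Subgroup.card_top, hG, hH, smul_smul]
  simp [sq]

/-- In `e_H`, the `Ĝ` term contributes the norm, which is zero, while `Ĥ` acts on an `H`-fixed
vector as `p`. -/
theorem idem_sub_apply_of_norm_eq_zero {H : Subgroup G} (hH : Nat.card H = p) {u : U}
    (hu : ∀ h ∈ H, ρ h u = u) (hn : ρ.norm u = 0) :
    (ratRep ρ).asAlgebraHom (idem p (.sub H hH)) (1 ⊗ₜ u) = 1 ⊗ₜ u := by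
  have hp0 : (p : ℚ_[p]) ≠ 0 := by exact_mod_cast hp.out.ne_zero
  rw [idem, map_smul, map_sub, map_smul, LinearMap.smul_apply, LinearMap.sub_apply,
    LinearMap.smul_apply, asAlgebraHom_hat_top, hn, TensorProduct.tmul_zero, sub_zero,
    asAlgebraHom_of_forall_fixed ρ H fun h hh => by simp [ratRep, hu h hh], hH, smul_smul,
    smul_smul]
  have : 1 / (p : ℚ_[p]) ^ 2 * p * p = 1 := by field_simp
  rw [this, one_smul]

theorem idem_zero_add_idem_sub_apply {H : Subgroup G} (hH : Nat.card H = p)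
    {w : ℚ_[p] ⊗[ℤ_[p]] U} (hw : ∀ h ∈ H, ratRep ρ h w = w) :
    (ratRep ρ).asAlgebraHom (idem p .zero) w + (ratRep ρ).asAlgebraHom (idem p (.sub H hH)) w =
      w := by
  have hp0 : (p : ℚ_[p]) ≠ 0 := by exact_mod_cast hp.out.ne_zero
  rw [← LinearMap.add_apply, ← map_add, idem_zero_add_idem_sub, map_smul, LinearMap.smul_apply,
    asAlgebraHom_of_forall_fixed ρ H hw, hH, smul_smul, inv_mul_cancel₀ hp0, one_smul]

theorem ratRep_apply_of_mem_zero {x : ℚ_[p] ⊗[ℤ_[p]] U}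
    (hx : x ∈ (compSub ρ .zero).toSubmodule) (g : G) : ratRep ρ g x = x := by
  obtain ⟨w, -, rfl⟩ := hx
  simp only [LinearMap.coe_restrictScalars]
  rw [ratRep_eq_asAlgebraHom, asAlgebraHom_mul_apply, single_mul_idem_zero]

theorem ratRep_apply_of_mem_sub {H : Subgroup G} {hH : Nat.card H = p} {x : ℚ_[p] ⊗[ℤ_[p]] U}
    (hx : x ∈ (compSub ρ (.sub H hH)).toSubmodule) {g : G} (hg : g ∈ H) : ratRep ρ g x = x := by
  obtain ⟨w, -, rfl⟩ := hx
  simp only [LinearMap.coe_restrictScalars]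
  rw [ratRep_eq_asAlgebraHom, asAlgebraHom_mul_apply, single_mul_idem_sub hH hg]

theorem asAlgebraHom_hat_top_ratRep (g : G) (w : ℚ_[p] ⊗[ℤ_[p]] U) :
    (ratRep ρ).asAlgebraHom (hat p ⊤) (ratRep ρ g w) = (ratRep ρ).asAlgebraHom (hat p ⊤) w := by
  rw [ratRep_eq_asAlgebraHom, asAlgebraHom_mul_apply, mul_comm,
    single_mul_hat _ (Subgroup.mem_top g)]

theorem one_tmul_injective [Module.Free ℤ_[p] U] : Function.Injective fun u : U => (1 : ℚ_[p]) ⊗ₜ[ℤ_[p]] u :=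
  Module.Flat.tensorProduct_mk_injective _ _ _

theorem ratRep_one_tmul (g : G) (u : U) :
    ratRep ρ g (1 ⊗ₜ u) = (1 : ℚ_[p]) ⊗ₜ[ℤ_[p]] ρ g u := by
  simp [ratRep]

variable [Module.Free ℤ_[p] U]

/-- If the first cohomology of `U^N` vanishes, then `V_(N)^G ⊆ V_(0)`. -/
theorem mem_quotSub_zero_of_norm (hG : Nat.card G = p ^ 2) {N : Subgroup G} (hN : Nat.card N = p)
    {c : G} (hc : ∀ g, ∃ h ∈ N, ∃ j : ℕ, g = h * c ^ j)
    (hU : ∀ u, (∀ n ∈ N, ρ n u = u) → ρ.norm u = 0 →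
      ∃ m, (∀ n ∈ N, ρ n m = m) ∧ ρ c m - m = u)
    {x : QuotV ρ} (hx : x ∈ (quotSub ρ (.sub N hN)).toSubmodule)
    (hxG : ∀ g, quotRep ρ g x = x) : x ∈ (quotSub ρ .zero).toSubmodule := by
  obtain ⟨⟨v, hv⟩, hvN, rfl⟩ := hx
  have hvN' : v ∈ (compSub ρ (.sub N hN)).toSubmodule := hvN
  obtain ⟨k, hk⟩ := (mk_mem_invariants_iff ρ ⟨v, hv⟩ c).1 (hxG c)
  change (1 : ℚ_[p]) ⊗ₜ[ℤ_[p]] k = ratRep ρ c v - v at hk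
  have hcomm : ∀ g h w, ratRep ρ g (ratRep ρ h w) = ratRep ρ h (ratRep ρ g w) := by
    intro g h w
    rw [← Module.End.mul_apply, ← map_mul, mul_comm, map_mul, Module.End.mul_apply]
  have hkN : ∀ n ∈ N, ρ n k = k := by
    intro n hn
    apply one_tmul_injective (p := p)
    change (1 : ℚ_[p]) ⊗ₜ[ℤ_[p]] ρ n k = 1 ⊗ₜ k
    rw [← ratRep_one_tmul, hk, map_sub, hcomm, ratRep_apply_of_mem_sub hvN' hn]
  have hkn : ρ.norm k = 0 := by
    apply one_tmul_injective (p := p)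
    change (1 : ℚ_[p]) ⊗ₜ[ℤ_[p]] ρ.norm k = 1 ⊗ₜ 0
    rw [← asAlgebraHom_hat_top, hk, map_sub, asAlgebraHom_hat_top_ratRep, sub_self,
      TensorProduct.tmul_zero]
  obtain ⟨m, hmN, hm⟩ := hU k hkN hkn
  have hmN' : ∀ n ∈ N, ratRep ρ n (1 ⊗ₜ m) = 1 ⊗ₜ m := fun n hn => by
    rw [ratRep_one_tmul, hmN n hn]
  -- Both terms are fixed by `N`, and `c - 1` takes the same value `k` on both.
  have hz : ∀ g, ratRep ρ g (v - 1 ⊗ₜ m) = v - 1 ⊗ₜ m := by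
    have h1 : ratRep ρ c (v - 1 ⊗ₜ m) = v - 1 ⊗ₜ m := by
      rw [map_sub, ratRep_one_tmul, sub_eq_sub_iff_sub_eq_sub, ← hk, ← hm, TensorProduct.tmul_sub]
    intro g
    obtain ⟨n, hn, j, rfl⟩ := hc g
    have h2 : ∀ j : ℕ, ratRep ρ (c ^ j) (v - 1 ⊗ₜ m) = v - 1 ⊗ₜ m := by
      intro j
      induction j with
      | zero => simp
      | succ j ih => rw [pow_succ, map_mul, Module.End.mul_apply, h1, ih]
    rw [map_mul, Module.End.mul_apply, h2, map_sub, ratRep_apply_of_mem_sub hvN' hn, hmN' n hn]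
  -- Apply `e_N`: it kills the `G`-fixed vector `v - m` and fixes `v`.
  have hv' : v = (ratRep ρ).asAlgebraHom (idem p (.sub N hN)) (1 ⊗ₜ m) := by
    have := idem_sub_apply_of_fixed hG hN hz
    rwa [map_sub, idem_sub_apply_of_mem ρ hG hvN', sub_eq_zero] at this
  -- On `N`-fixed vectors `e_0 + e_N` is the identity, so `v + e_0 m = m ∈ U`, and `-e_0 m`
  -- represents the class of `v`.
  refine (mk_mem_quotSub_iff ρ .zero ⟨v, hv⟩).2
    ⟨-(ratRep ρ).asAlgebraHom (idem p .zero) (1 ⊗ₜ m), neg_mem ⟨_, ⟨m, rfl⟩, rfl⟩, m, ?_⟩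
  change (1 : ℚ_[p]) ⊗ₜ[ℤ_[p]] m = v - -_
  rw [sub_neg_eq_add, add_comm, hv', idem_zero_add_idem_sub_apply hN hmN']

/-- If `V_(N)^G ⊆ V_(0)` and `U` has no summands `Λ_(N)`, the first cohomology of `U^N`
vanishes. -/
theorem exists_sub_eq_of_quotSub [Module.Finite ℤ_[p] U] (hG : Nat.card G = p ^ 2)
    (hexp : ∀ g : G, g ^ p = 1) {N : Subgroup G}
    (hN : Nat.card N = p) {c : G} (hc : ∀ g, ∃ h ∈ N, ∃ j : ℕ, g = h * c ^ j)
    (hred : ¬ HasDirectSummand ρ (lambdaRep p (.sub N hN)))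
    (hV : ∀ x ∈ (quotSub ρ (.sub N hN)).toSubmodule, (∀ g, quotRep ρ g x = x) →
      x ∈ (quotSub ρ .zero).toSubmodule)
    {u : U} (hu : ∀ n ∈ N, ρ n u = u) (hn : ρ.norm u = 0) :
    ∃ m, (∀ n ∈ N, ρ n m = m) ∧ ρ c m - m = u := by
  obtain ⟨x, hx, hxu⟩ := exists_compSub_sub_eq ρ hG hexp hN hc hred
    (idem_sub_apply_of_norm_eq_zero hN hu hn)
  have hxs : x ∈ (starSub ρ).toSubmodule := Submodule.mem_iSup_of_mem _ hx
  -- The class of `x` is fixed by `G`: `N` fixes `x` itself, and `c x - x = u` lies in `U`.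
  have hxg : ∀ g, ratRep ρ g x - x ∈ (latSub ρ).toSubmodule := by
    intro g
    obtain ⟨n, hn, j, rfl⟩ := hc g
    rw [mul_comm, map_mul, Module.End.mul_apply, ratRep_apply_of_mem_sub hx hn]
    induction j with
    | zero => simp
    | succ j ih =>
      have h1 : ratRep ρ (c ^ (j + 1)) x - x =
          ratRep ρ c (ratRep ρ (c ^ j) x - x) + (ratRep ρ c x - x) := by
        rw [pow_succ', map_mul, Module.End.mul_apply, map_sub]
        abel
      rw [h1]
      exact add_mem ((latSub ρ).apply_mem_toSubmodule c ih) ⟨u, hxu.symm⟩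
  -- Take `m = x - y ∈ U` with `y ∈ U_(0)`. Since `G` fixes `y`, `m` is still fixed by `N` and `c m
  -- - m = u`.
  obtain ⟨y, hy, m, hm⟩ := (mk_mem_quotSub_iff ρ .zero ⟨x, hxs⟩).1
    (hV (Submodule.mkQ _ ⟨x, hxs⟩) ((mk_mem_quotSub_iff ρ _ ⟨x, hxs⟩).2 ⟨x, hx, by simp⟩)
      fun g => (mk_mem_invariants_iff ρ ⟨x, hxs⟩ g).2 (hxg g))
  change (1 : ℚ_[p]) ⊗ₜ[ℤ_[p]] m = x - y at hm
  refine ⟨m, fun n hn => ?_, ?_⟩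
  · apply one_tmul_injective (p := p)
    change (1 : ℚ_[p]) ⊗ₜ[ℤ_[p]] ρ n m = 1 ⊗ₜ m
    rw [← ratRep_one_tmul, hm, map_sub, ratRep_apply_of_mem_sub hx hn, ratRep_apply_of_mem_zero hy]
  · apply one_tmul_injective (p := p)
    change (1 : ℚ_[p]) ⊗ₜ[ℤ_[p]] (ρ c m - m) = 1 ⊗ₜ u
    rw [TensorProduct.tmul_sub, ← ratRep_one_tmul, hm, map_sub, ratRep_apply_of_mem_zero hy, ← hxu]
    abel

/-- `U^N` is a permutation module if and only if its first cohomology vanishes. -/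
theorem isPermutationModule_quotientToInvariants_iff [Module.Finite ℤ_[p] U] {N : Subgroup G}
    (hN : Nat.card N = p) (hcard : Nat.card (G ⧸ N) = p) {c : G}
    (hc : ∀ q : G ⧸ N, q ∈ Subgroup.zpowers (QuotientGroup.mk c : G ⧸ N)) :
    IsPermutationModule (ρ.quotientToInvariants N) ↔
      ∀ u, (∀ n ∈ N, ρ n u = u) → ρ.norm u = 0 →
        ∃ m, (∀ n ∈ N, ρ n m = m) ∧ ρ c m - m = u := by
  have := Fintype.ofFinite (G ⧸ N)
  have hnorm : ∀ m, (ρ.quotientToInvariants N).norm m = 0 ↔ ρ.norm m.1 = 0 := by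
    intro m
    have hp0 : (p : ℤ_[p]) ≠ 0 := by exact_mod_cast hp.out.ne_zero
    rw [← nsmul_norm_quotientToInvariants, hN, ← Nat.cast_smul_eq_nsmul ℤ_[p], smul_eq_zero,
      or_iff_right hp0, ZeroMemClass.coe_eq_zero]
  constructor
  · intro h u hu hn
    let u' : Representation.invariants (ρ.comp N.subtype) := ⟨u, fun n => hu n.1 n.2⟩
    obtain ⟨m, hm⟩ := mem_range_sub_one _ hc (h.mem_coinvariants_ker ((hnorm u').2 hn))
    exact ⟨m.1, fun n hn => m.2 ⟨n, hn⟩, congrArg Subtype.val hm⟩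
  · intro h
    refine isPermutationModule_of_norm hcard _ (fun u hn => ?_) hc
    obtain ⟨m, hmN, hm⟩ := h u.1 (fun n hn => u.2 ⟨n, hn⟩) ((hnorm u).1 hn)
    exact ⟨⟨m, fun n => hmN n.1 n.2⟩, Subtype.ext hm⟩

end FixedPoints

end Butler

end

theorem mainTheorem3 {p : ℕ} [Fact p.Prime] {G : Type*} [CommGroup G] [Fintype G]
    (hG : Butler.IsCpCp p G) (N : Subgroup G) (hN : Nat.card N = p)
    {U : Type*} [AddCommGroup U] [Module ℤ_[p] U] [Module.Free ℤ_[p] U] [Module.Finite ℤ_[p] U]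
    (ρ : Representation ℤ_[p] G U) (hρ : Butler.IsReduced ρ) :
    Butler.IsPermutationModule (ρ.quotientToInvariants N) ↔
      ((Butler.diagram hG ρ hρ).sub (.sub N hN)).toSubmodule ⊓
          (Butler.diagram hG ρ hρ).rep.invariants ≤
        ((Butler.diagram hG ρ hρ).sub .zero).toSubmodule := by
  obtain ⟨c, hcard, hgen, hc⟩ := Butler.exists_quotient_generator hG.card_eq hN
  rw [Butler.isPermutationModule_quotientToInvariants_iff hN hcard hgen]
  constructor
  · rintro h x ⟨hx, hxG⟩
    -- Passing from `ℤ_p` to `𝔽_p` scalars in the diagram changes neither the underlying sets nor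
    -- the action, so the memberships agree definitionally.
    exact Butler.mem_quotSub_zero_of_norm hG.card_eq hN hc h hx hxG
  · intro h u hu hn
    exact Butler.exists_sub_eq_of_quotSub hG.card_eq hG.pow_eq_one hN hc (hρ.2 _)
      (fun x hx hxG => h ⟨hx, hxG⟩) hu hn
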